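/- Let $K_0$ be an algebraically closed field, $p$ a prime number different from $\mathrm{char}(K_0)$, and $\varepsilon_m$ $(m = 1, 2, \dots)$ a sequence of elements of $K_0$ such that $\varepsilon_1 \neq 1 = \varepsilon_1^p$ and $\varepsilon_{m+1}^p = \varepsilon_m$ for every $m \ge 1$. Let $n \ge 0$ be an integer, let $C = K_0(x_i, y_i : i = 1, \dots, n)$ be a purely transcendental extension of $K_0$ in the $2n$ algebraically independent elements $x_1, \dots, x_n, y_1, \dots, y_n$, and let $L = C(\sqrt[p]{y_i} : i = 1, \dots, n)$, with arbitrary fixed choices of the $p$-th roots. For positive integers $m_1, \dots, m_n$, let $V_j = L(x_j, \sqrt[p]{y_j}; \varepsilon_{m_j})_{p^{m_j}}$ be the symbol algebra, that is, the associative unital $L$-algebra with generators $\xi_j, \eta_j$ subject to the relations $$\eta_j \xi_j = \varepsilon_{m_j} \xi_j \eta_j, \qquad \xi_j^{p^{m_j}} = x_j, \qquad \eta_j^{p^{m_j}} = \sqrt[p]{y_j},$$ and let $S$ be an $L$-algebra isomorphic to $V_1 \otimes_L \cdots \otimes_L V_n$ (which means $L$ if $n = 0$). Then: 1. each of the algebras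 $V_1, \dots, V_n$ and $S$ is a finite-dimensional central division algebra over $L$; 2. $C$ is the only central $C$-subalgebra of $S$: a unital $C$-subalgebra $T$ of $S$ has centre equal to $C$ if and only if $T = C$; 3. $[V_j : L] = p^{2m_j}$ for each $j = 1, \dots, n$. -/

import Mathlib

open scoped TensorProduct

/-- The defining relations of a symbol algebra. The free generator `0` is `ξ` and the free
generator `1` is `η`. -/
inductive SymbolAlgebra.Rel {F : Type*} [CommRing F] (a b ζ : F) (N : ℕ) :
    FreeAlgebra F (Fin 2) → FreeAlgebra F (Fin 2) → Prop
  | comm : SymbolAlgebra.Rel a b ζ N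
      (FreeAlgebra.ι F 1 * FreeAlgebra.ι F 0) (ζ • (FreeAlgebra.ι F 0 * FreeAlgebra.ι F 1))
  | xi_pow : SymbolAlgebra.Rel a b ζ N
      (FreeAlgebra.ι F 0 ^ N) (algebraMap F (FreeAlgebra F (Fin 2)) a)
  | eta_pow : SymbolAlgebra.Rel a b ζ N
      (FreeAlgebra.ι F 1 ^ N) (algebraMap F (FreeAlgebra F (Fin 2)) b)

/-- The symbol algebra `F(a, b; ζ)_N`: the associative unital `F`-algebra with generators `ξ, η`
and relations `η ξ = ζ ξ η`, `ξ ^ N = a`, `η ^ N = b`. -/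
abbrev SymbolAlgebra {F : Type*} [CommRing F] (a b ζ : F) (N : ℕ) : Type _ :=
  RingQuot (SymbolAlgebra.Rel a b ζ N)

/-- `A` belongs to `d(F)`: it is a finite-dimensional central division algebra over `F`. -/
structure IsCentralDivisionAlgebra (F A : Type*) [Field F] [Ring A] [Algebra F A] : Prop where
  finite : Module.Finite F A
  nontrivial : Nontrivial A
  isUnit_of_ne_zero : ∀ a : A, a ≠ 0 → IsUnit a
  center_eq : Subalgebra.center F A = ⊥

/-! Write `N_j = p ^ m_j`. Since `η_j ^ (p * N_j) = y_j`, monomials in the `ξ_j, η_j` form a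
`C`-basis of `S` indexed by the finite group `ι = ∏ ZMod N_j × ZMod (p * N_j)`
(`exists_monomialBasis`). Embedding `L` in a Hahn series field gives a valuation, trivial on `K₀`,
for which these monomials can be assigned values in distinct cosets of the value group of `C`
(`exists_valuation_of_adjoin_roots`). It extends to `S` with the monomials orthogonal, and is
multiplicative because dominant monomials multiply without cancellation. So `S` is a
finite-dimensional domain, hence a division algebra, and each `V_j` embeds in it. Centres and
`L`-bases come from monomials being simultaneous eigenvectors of conjugations with distinct
characters.

Let `T` have centre `C`, and let `H ⊆ ι` be the set of degrees of dominant monomials of elements of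
`T`; then `|H| = dim T`. If the monomial of degree `i ∈ H` commutes with all those of degree in `H`,
averaging an element `a` of degree `i` over dual bases yields a central element with dominant part
`|H| a`. As `p` is invertible in `K₀`, `|H|` has value `1`; this central element lies in `C`, so `i
= 0` (`eq_zero_of_commute_leads`). Commutators of monomials involve only `N_j`-th roots of unity,
whereas the degree in `η_j` counts modulo `p * N_j`. Hence if `p ^ (k + 1)` kills `H`, the monomials
with degrees in `p ^ k H` commute with all those with degrees in `H`, so `p ^ k` already kills `H`.
Descent gives `H = 0` and `T = C` (`eq_bot_of_center_eq_bot`). -/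

/-! ### Extending a valuation along an orthogonal monomial basis. -/

/-- Vectors whose nonzero scalar multiples never share a value are linearly independent. -/
theorem Valuation.linearIndependent_of_injective {C R Γ₀ ι : Type*} [Field C] [Ring R]
    [Algebra C R] [LinearOrderedCommGroupWithZero Γ₀] (w : Valuation R Γ₀) (f : ι → R)
    (hne : ∀ i (k : C), k ≠ 0 → w (k • f i) ≠ 0)
    (hinj : ∀ i j (k l : C), k ≠ 0 → l ≠ 0 → w (k • f i) = w (l • f j) → i = j) :
    LinearIndependent C f := by
  classical
  rw [linearIndependent_iff']
  intro s g hs i hi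
  by_contra hgi
  have hne' : (s.filter fun i => g i ≠ 0).Nonempty := ⟨i, by simp [hi, hgi]⟩
  obtain ⟨j, hj, hmax⟩ := Finset.exists_max_image _ (fun i => w (g i • f i)) hne'
  have hgj : g j ≠ 0 := (Finset.mem_filter.mp hj).2
  have hsum : ∑ i ∈ s.filter (fun i => g i ≠ 0), g i • f i = 0 := by
    rw [Finset.sum_filter_of_ne, hs]
    intro i _ h h0
    exact h (by rw [h0, zero_smul])
  have := w.map_sum_eq_of_lt (f := fun i => g i • f i) hj (by
    intro k hk
    rw [Finset.mem_sdiff, Finset.mem_singleton] at hk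
    refine lt_of_le_of_ne (hmax k hk.1) fun h => hk.2 ?_
    exact hinj _ _ _ _ (Finset.mem_filter.mp hk.1).2 hgj h)
  rw [hsum, map_zero] at this
  exact hne j _ hgj this.symm

/-- A basis of a `C`-algebra, graded by `ι`, whose elements multiply to scalar multiples of one
another, together with values making the basis orthogonal for a valuation of `C`. -/
structure MonomialBasis {C Γ₀ : Type*} [Field C] [LinearOrderedCommGroupWithZero Γ₀]
    (v : Valuation C Γ₀) (ι S : Type*) [AddCommGroup ι] [Ring S] [Algebra C S] where
  basis : Module.Basis ι C S
  coef : ι → ι → C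
  value : ι → Γ₀
  basis_zero : basis 0 = 1
  basis_mul : ∀ i j, basis i * basis j = coef i j • basis (i + j)
  value_ne_zero : ∀ i, value i ≠ 0
  map_coef : ∀ i j, v (coef i j) * value (i + j) = value i * value j
  separated : ∀ i j (k l : C), k ≠ 0 → l ≠ 0 → v k * value i = v l * value j → i = j

namespace MonomialBasis

variable {C Γ₀ ι S : Type*} [Field C] [LinearOrderedCommGroupWithZero Γ₀]
  {v : Valuation C Γ₀} [AddCommGroup ι] [Ring S] [Algebra C S]
  (B : MonomialBasis v ι S)

theorem value_zero : B.value 0 = 1 := by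
  have h1 : B.coef 0 0 = 1 := by
    have h := B.basis_mul 0 0
    rw [add_zero, B.basis_zero, mul_one, ← B.basis_zero] at h
    simpa using (congrArg (fun s => B.basis.repr s 0) h).symm
  have h := B.map_coef 0 0
  rw [h1, map_one, one_mul, add_zero] at h
  exact (mul_eq_left₀ (B.value_ne_zero 0)).mp h.symm

theorem coef_ne_zero (i j : ι) : B.coef i j ≠ 0 := by
  intro h
  have := B.map_coef i j
  rw [h, map_zero, zero_mul] at this
  exact mul_ne_zero (B.value_ne_zero i) (B.value_ne_zero j) this.symm

/-- The coefficient of `1`. -/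
noncomputable def constCoeff : S →ₗ[C] C := B.basis.coord 0

theorem constCoeff_algebraMap (c : C) : B.constCoeff (algebraMap C S c) = c := by
  rw [Algebra.algebraMap_eq_smul_one, map_smul, ← B.basis_zero, constCoeff, Module.Basis.coord_apply,
    Module.Basis.repr_self]
  simp

variable [Fintype ι]

/-- The underlying function of the extension of the valuation. -/
noncomputable def norm (s : S) : Γ₀ := Finset.univ.sup' ⟨0, Finset.mem_univ _⟩
  fun i => v (B.basis.repr s i) * B.value i

theorem norm_le_iff {s : S} {g : Γ₀} :
    B.norm s ≤ g ↔ ∀ i, v (B.basis.repr s i) * B.value i ≤ g := by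
  exact (Finset.sup'_le_iff _ _).trans (by simp)

theorem le_norm (s : S) (i : ι) : v (B.basis.repr s i) * B.value i ≤ B.norm s :=
  B.norm_le_iff.mp le_rfl i

theorem exists_norm_eq (s : S) : ∃ i, B.norm s = v (B.basis.repr s i) * B.value i := by
  obtain ⟨i, -, hi⟩ := Finset.exists_mem_eq_sup' ⟨0, Finset.mem_univ _⟩
    fun i => v (B.basis.repr s i) * B.value i
  exact ⟨i, hi⟩

theorem norm_zero : B.norm 0 = 0 := by
  obtain ⟨i, hi⟩ := B.exists_norm_eq 0
  simpa using hi

theorem norm_add (s t : S) : B.norm (s + t) ≤ max (B.norm s) (B.norm t) := by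
  rw [norm_le_iff]
  intro i
  rw [map_add, Finsupp.add_apply]
  rcases v.map_add' (B.basis.repr s i) (B.basis.repr t i) with h | h
  · exact le_max_of_le_left ((mul_le_mul_left h _).trans (B.le_norm s i))
  · exact le_max_of_le_right ((mul_le_mul_left h _).trans (B.le_norm t i))

theorem norm_smul (c : C) (s : S) : B.norm (c • s) = v c * B.norm s := by
  apply le_antisymm
  · rw [norm_le_iff]
    intro i
    rw [map_smul, Finsupp.smul_apply, smul_eq_mul, map_mul, mul_assoc]
    exact mul_le_mul_right (B.le_norm s i) _
  · obtain ⟨i, hi⟩ := B.exists_norm_eq s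
    have := B.le_norm (c • s) i
    rwa [map_smul, Finsupp.smul_apply, smul_eq_mul, map_mul, mul_assoc, ← hi] at this

theorem norm_neg (s : S) : B.norm (-s) = B.norm s := by
  rw [← neg_one_smul C s, norm_smul, Valuation.map_neg, map_one, one_mul]

theorem norm_basis (i : ι) : B.norm (B.basis i) = B.value i := by
  classical
  apply le_antisymm
  · rw [norm_le_iff]
    intro j
    rw [Module.Basis.repr_self, Finsupp.single_apply]
    split_ifs with h
    · simp [h]
    · simp
  · simpa using B.le_norm (B.basis i) i

theorem norm_sum_le {κ : Type*} (s : Finset κ) (f : κ → S) {g : Γ₀} (h : ∀ i ∈ s, B.norm (f i) ≤ g) :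
    B.norm (∑ i ∈ s, f i) ≤ g := by
  classical
  induction s using Finset.induction_on with
  | empty => simp [norm_zero]
  | insert a s ha ih =>
    rw [Finset.sum_insert ha]
    exact (B.norm_add _ _).trans (max_le (h a (Finset.mem_insert_self _ _))
      (ih fun i hi => h i (Finset.mem_insert_of_mem hi)))

theorem norm_mul_le (s t : S) : B.norm (s * t) ≤ B.norm s * B.norm t := by
  conv_lhs => rw [← B.basis.sum_repr s, ← B.basis.sum_repr t, Finset.sum_mul_sum]
  refine B.norm_sum_le _ _ fun i _ => B.norm_sum_le _ _ fun j _ => ?_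
  rw [smul_mul_smul_comm, B.basis_mul, smul_smul, norm_smul, norm_basis, map_mul, mul_assoc,
    B.map_coef, map_mul, mul_mul_mul_comm]
  exact mul_le_mul' (B.le_norm s i) (B.le_norm t j)

theorem norm_add_eq {s t : S} (h : B.norm t < B.norm s) : B.norm (s + t) = B.norm s := by
  apply le_antisymm ((B.norm_add s t).trans (max_le le_rfl h.le))
  have := B.norm_add (s + t) (-t)
  rw [add_neg_cancel_right, norm_neg] at this
  rcases le_max_iff.mp this with h1 | h1
  · exact h1
  · exact absurd h1 (not_le.mpr h)

theorem norm_eq_zero {s : S} (h : B.norm s = 0) : s = 0 := by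
  refine B.basis.ext_elem fun i => ?_
  have := B.le_norm s i
  rw [h, le_zero_iff, mul_eq_zero] at this
  simpa [B.value_ne_zero] using this

/-! ### Dominant monomials and multiplicativity of the extended valuation. -/

/-- `i` is the degree of the dominant monomial of `s`. -/
def IsLead (s : S) (i : ι) : Prop :=
  B.basis.repr s i ≠ 0 ∧ B.norm s = v (B.basis.repr s i) * B.value i ∧
    B.norm (s - B.basis.repr s i • B.basis i) < B.norm s

/-- By `separated`, two nonzero terms of equal value have equal degree, so the maximum is attained
exactly once. -/
theorem exists_isLead {s : S} (hs : s ≠ 0) : ∃ i, B.IsLead s i := by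
  classical
  obtain ⟨i, hi⟩ := B.exists_norm_eq s
  have h0 : B.norm s ≠ 0 := fun h => hs (B.norm_eq_zero h)
  have hc : B.basis.repr s i ≠ 0 := by
    intro h
    rw [h, map_zero, zero_mul] at hi
    exact h0 hi
  refine ⟨i, hc, hi, ?_⟩
  obtain ⟨j, hj⟩ := B.exists_norm_eq (s - B.basis.repr s i • B.basis i)
  rw [hj, map_sub, map_smul, Module.Basis.repr_self, Finsupp.sub_apply, Finsupp.smul_apply,
    Finsupp.single_apply]
  split_ifs with h
  · subst h
    simpa using zero_lt_iff.mpr h0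
  · rw [smul_zero, sub_zero]
    refine lt_of_le_of_ne (B.le_norm s j) fun h' => h ?_
    by_cases hsj : B.basis.repr s j = 0
    · rw [hsj, map_zero, zero_mul] at h'
      exact absurd h'.symm h0
    · exact B.separated _ _ _ _ hc hsj (hi.symm.trans h'.symm)

theorem norm_mul (s t : S) : B.norm (s * t) = B.norm s * B.norm t := by
  by_cases hs : s = 0
  · simp [hs, norm_zero]
  by_cases ht : t = 0
  · simp [ht, norm_zero]
  obtain ⟨i, -, hi, hi'⟩ := B.exists_isLead hs
  obtain ⟨j, -, hj, hj'⟩ := B.exists_isLead ht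
  set x := B.basis.repr s i • B.basis i with hx
  set y := B.basis.repr t j • B.basis j with hy
  have hnx : B.norm x = B.norm s := by rw [hx, norm_smul, norm_basis, hi]
  have hny : B.norm y = B.norm t := by rw [hy, norm_smul, norm_basis, hj]
  have hs0 : 0 < B.norm s := zero_le.trans_lt hi'
  have ht0 : 0 < B.norm t := zero_le.trans_lt hj'
  have hxy : B.norm (x * y) = B.norm s * B.norm t := by
    rw [hx, hy, smul_mul_smul_comm, B.basis_mul, smul_smul, norm_smul, norm_basis, map_mul,
      mul_assoc, B.map_coef, map_mul, mul_mul_mul_comm, ← hi, ← hj]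
  -- `s * t` is `x * y` plus this strictly smaller remainder, so the product of the dominant terms
  -- cannot be cancelled.
  have hrest : B.norm (x * (t - y) + (s - x) * t) < B.norm (x * y) := by
    rw [hxy]
    refine (B.norm_add _ _).trans_lt (max_lt ?_ ?_)
    · refine (B.norm_mul_le _ _).trans_lt ?_
      rw [hnx]
      exact mul_lt_mul_of_pos_left hj' hs0
    · exact (B.norm_mul_le _ _).trans_lt (mul_lt_mul_of_pos_right hi' ht0)
  have := B.norm_add_eq hrest
  rw [hxy] at this
  rw [← this]
  congr 1
  noncomm_ring

/-- The extension of the valuation of `C` for which the basis is orthogonal. -/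
noncomputable def valuation : Valuation S Γ₀ where
  toFun := B.norm
  map_zero' := B.norm_zero
  map_one' := by rw [← B.basis_zero, norm_basis, value_zero]
  map_mul' := B.norm_mul
  map_add_le_max' := B.norm_add

theorem valuation_apply (s : S) : B.valuation s = B.norm s := rfl

theorem valuation_eq_zero {s : S} : B.valuation s = 0 ↔ s = 0 :=
  ⟨B.norm_eq_zero, fun h => by rw [h, map_zero]⟩

theorem valuation_algebraMap (c : C) : B.valuation (algebraMap C S c) = v c := by
  rw [Algebra.algebraMap_eq_smul_one, valuation_apply, norm_smul, ← valuation_apply, map_one,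
    mul_one]

theorem valuation_smul (c : C) (s : S) : B.valuation (c • s) = v c * B.valuation s :=
  B.norm_smul c s

theorem noZeroDivisors (B : MonomialBasis v ι S) : NoZeroDivisors S where
  eq_zero_or_eq_zero_of_mul_eq_zero {a b} h := by
    have := congrArg B.valuation h
    rwa [map_mul, map_zero, mul_eq_zero, valuation_eq_zero, valuation_eq_zero] at this

variable {B} in
theorem IsLead.unique {s : S} {i j : ι} (hi : B.IsLead s i) (hj : B.IsLead s j) : i = j :=
  B.separated _ _ _ _ hi.1 hj.1 (hi.2.1.symm.trans hj.2.1)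

/-- The degree depends only on the value modulo the values of `C`; this turns later value
computations into statements on degrees. -/
theorem isLead_of_norm_eq {s : S} {i : ι} {k : C} (hk : k ≠ 0)
    (h : B.valuation s = v k * B.value i) : B.IsLead s i := by
  have hs : s ≠ 0 := by
    rintro rfl
    rw [map_zero] at h
    exact mul_ne_zero ((Valuation.ne_zero_iff v).mpr hk) (B.value_ne_zero i) h.symm
  obtain ⟨j, hj⟩ := B.exists_isLead hs
  obtain rfl : i = j := B.separated _ _ _ _ hk hj.1 (h.symm.trans hj.2.1)
  exact hj

variable {B} in
theorem IsLead.mul {s t : S} {i j : ι} (hi : B.IsLead s i) (hj : B.IsLead t j) :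
    B.IsLead (s * t) (i + j) := by
  refine B.isLead_of_norm_eq
    (mul_ne_zero (mul_ne_zero hi.1 hj.1) (B.coef_ne_zero i j)) ?_
  rw [map_mul, valuation_apply, valuation_apply, hi.2.1, hj.2.1, map_mul, map_mul, mul_assoc _ _ (B.value _),
    B.map_coef, mul_mul_mul_comm]

theorem isLead_one : B.IsLead 1 0 :=
  B.isLead_of_norm_eq one_ne_zero (by rw [map_one, map_one, value_zero, mul_one])

variable {B} in
theorem IsLead.pow {s : S} {i : ι} (hi : B.IsLead s i) (n : ℕ) : B.IsLead (s ^ n) (n • i) := by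
  induction n with
  | zero => simpa using B.isLead_one
  | succ n ih => rw [pow_succ, succ_nsmul]; exact IsLead.mul ih hi

variable {B} in
theorem IsLead.ne_zero {s : S} {i : ι} (hi : B.IsLead s i) : s ≠ 0 := by
  rintro rfl
  exact hi.1 (by simp)

/-- Elements with commuting dominant monomials commute up to terms of smaller value. -/
theorem valuation_commutator_lt {s t : S} {i j : ι} (hi : B.IsLead s i) (hj : B.IsLead t j)
    (hc : Commute (B.basis i) (B.basis j)) :
    B.valuation (s * t - t * s) < B.valuation s * B.valuation t := by
  obtain ⟨-, hi, hi'⟩ := hi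
  obtain ⟨-, hj, hj'⟩ := hj
  set x := B.basis.repr s i • B.basis i with hx
  set y := B.basis.repr t j • B.basis j with hy
  have hxy : x * y = y * x := ((hc.smul_left _).smul_right _).eq
  have hnx : B.valuation x = B.valuation s := by
    rw [hx, valuation_apply, norm_smul, norm_basis, valuation_apply, hi]
  have hs0 : 0 < B.valuation s := zero_le.trans_lt hi'
  have ht0 : 0 < B.valuation t := zero_le.trans_lt hj'
  have e : s * t - t * s = (x * (t - y) + (s - x) * t) - ((t - y) * x + t * (s - x)) := by
    have : s * t - t * s = (x * (t - y) + (s - x) * t) - ((t - y) * x + t * (s - x))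
      + (x * y - y * x) := by noncomm_ring
    rw [this, hxy, sub_self, add_zero]
  have h1 : B.valuation s * B.valuation (t - y) < B.valuation s * B.valuation t :=
    mul_lt_mul_of_pos_left hj' hs0
  have h2 : B.valuation (s - x) * B.valuation t < B.valuation s * B.valuation t :=
    mul_lt_mul_of_pos_right hi' ht0
  rw [e]
  refine Valuation.map_sub_lt _ (Valuation.map_add_lt _ ?_ ?_) (Valuation.map_add_lt _ ?_ ?_) <;>
    rw [map_mul]
  · rwa [hnx]
  · exact h2
  · rwa [hnx, mul_comm]
  · rwa [mul_comm]

variable {B} in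
/-- The coefficient of `1` dominates in an element of degree `0`. -/
theorem IsLead.valuation_constCoeff {s : S} (h : B.IsLead s 0) :
    v (B.constCoeff s) = B.valuation s ∧
      B.valuation (s - algebraMap C S (B.constCoeff s)) < B.valuation s := by
  obtain ⟨-, h1, h2⟩ := h
  rw [value_zero, mul_one] at h1
  rw [B.basis_zero, ← Algebra.algebraMap_eq_smul_one] at h2
  exact ⟨h1.symm, h2⟩

/-- Only pairs of monomials with `i + j = 0` contribute. Their two products are scalars, and
associativity of `b_i b_j b_i` shows that these agree. This makes `constCoeff` a symmetrizing form.
-/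
theorem constCoeff_mul_comm (s t : S) : B.constCoeff (s * t) = B.constCoeff (t * s) := by
  have hb : ∀ i j, B.constCoeff (B.basis i * B.basis j) = B.constCoeff (B.basis j * B.basis i) := by
    intro i j
    by_cases hij : i + j = 0
    · have h1 := B.basis_mul i j
      have h2 := B.basis_mul j i
      rw [hij, B.basis_zero] at h1
      rw [add_comm, hij, B.basis_zero] at h2
      have h3 : (B.coef i j - B.coef j i) • B.basis i = 0 := by
        have : B.basis i * B.basis j * B.basis i = B.basis i * (B.basis j * B.basis i) :=
          mul_assoc _ _ _
        rw [h1, h2, smul_mul_assoc, one_mul, mul_smul_comm, mul_one] at this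
        rw [sub_smul, this, sub_self]
      rw [smul_eq_zero, or_iff_left (B.basis.ne_zero i), sub_eq_zero] at h3
      rw [h1, h2, h3]
    · have hji : j + i ≠ 0 := by rwa [add_comm]
      rw [B.basis_mul, B.basis_mul]
      simp [constCoeff, hij, hji]
  rw [← B.basis.sum_repr s, ← B.basis.sum_repr t]
  simp only [Finset.sum_mul_sum, map_sum, smul_mul_smul_comm, map_smul]
  rw [Finset.sum_comm]
  exact Finset.sum_congr rfl fun i _ => Finset.sum_congr rfl fun j _ => by rw [hb, mul_comm]

end MonomialBasis

/-! ### Casimir elements of a symmetrizing form. -/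

section Casimir

variable {C A κ : Type*} [Field C] [Ring A] [Algebra C A] [Fintype κ]

/-- The Casimir sum attached to dual bases for a symmetrizing form takes central values. -/
theorem commute_sum_mul_mul_of_dual (l : A →ₗ[C] C) (hl : ∀ s t, l (s * t) = l (t * s))
    (w u : Module.Basis κ C A) (hw : ∀ z i, w.repr z i = l (z * u i))
    (hu : ∀ z i, u.repr z i = l (z * w i)) (x y : A) :
    Commute (∑ i, w i * x * u i) y := by
  -- Left multiplication by `y` in the basis `w` and right multiplication by `y` in the dual basis
  -- `u` have transposed matrices, so `y` can be moved across the sum.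
  have h1 : ∀ i, y * w i = ∑ j, l (y * w i * u j) • w j := fun i => by
    conv_lhs => rw [← w.sum_repr (y * w i)]
    simp only [hw]
  have h2 : ∀ j, u j * y = ∑ i, l (y * w i * u j) • u i := fun j => by
    conv_lhs => rw [← u.sum_repr (u j * y)]
    refine Finset.sum_congr rfl fun i _ => ?_
    rw [hu, hl, ← mul_assoc, hl, ← mul_assoc]
  rw [commute_iff_eq, Finset.sum_mul, Finset.mul_sum]
  calc ∑ j, w j * x * u j * y
      = ∑ j, ∑ i, l (y * w i * u j) • (w j * x * u i) := by
        refine Finset.sum_congr rfl fun j _ => ?_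
        rw [mul_assoc, h2, Finset.mul_sum]
        simp only [mul_smul_comm]
    _ = ∑ i, ∑ j, l (y * w i * u j) • (w j * x * u i) := Finset.sum_comm
    _ = ∑ i, y * (w i * x * u i) := by
        refine Finset.sum_congr rfl fun i _ => ?_
        rw [← mul_assoc, ← mul_assoc]
        conv_rhs => rw [h1, Finset.sum_mul, Finset.sum_mul]
        simp only [smul_mul_assoc]

end Casimir

theorem Valuation.map_natCast_le_one {R Γ₀ : Type*} [Ring R] [LinearOrderedCommGroupWithZero Γ₀]
    (v : Valuation R Γ₀) (n : ℕ) : v (n : R) ≤ 1 := by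
  induction n with
  | zero => simp
  | succ n ih => rw [Nat.cast_succ]; exact v.map_add_le ih v.map_one.le

/-! ### Subalgebras with centre `C`. -/

namespace MonomialBasis

variable {C Γ₀ ι S : Type*} [Field C] [LinearOrderedCommGroupWithZero Γ₀]
  {v : Valuation C Γ₀} [AddCommGroup ι] [Ring S] [Algebra C S]

theorem nontrivial (B : MonomialBasis v ι S) : Nontrivial S :=
  ⟨B.basis 0, 0, B.basis.ne_zero 0⟩

variable [Fintype ι] (B : MonomialBasis v ι S)

theorem isDomain (B : MonomialBasis v ι S) : IsDomain S :=
  have := B.nontrivial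
  have := B.noZeroDivisors
  NoZeroDivisors.to_isDomain S

theorem exists_inverse (B : MonomialBasis v ι S) (T : Subalgebra C S) {u : T} (hu : u ≠ 0) :
    ∃ t : T, t * u = 1 ∧ u * t = 1 := by
  have := B.isDomain
  have : Module.Finite C S := Module.Finite.of_basis B.basis
  let := divisionRingOfFiniteDimensional C T
  exact ⟨u⁻¹, inv_mul_cancel₀ hu, mul_inv_cancel₀ hu⟩

/-- `S` is a vector space over the division ring `T`. Used to see that `dim T` has value `1` as soon
as the order of `ι` does. -/
theorem finrank_dvd (B : MonomialBasis v ι S) (T : Subalgebra C S) :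
    Module.finrank C T ∣ Fintype.card ι := by
  have := B.isDomain
  have : Module.Finite C S := Module.Finite.of_basis B.basis
  let := divisionRingOfFiniteDimensional C T
  rw [← Module.finrank_eq_card_basis B.basis]
  exact ⟨_, (Module.finrank_mul_finrank C T S).symm⟩

/-- The degrees of the dominant monomials of the elements of `T`. -/
def leads (T : Subalgebra C S) : Set ι := {i | ∃ t ∈ T, B.IsLead t i}

theorem exists_basis_leads (T : Subalgebra C S) :
    ∃ w : Module.Basis (B.leads T) C T, ∀ i, B.IsLead (w i : S) i := by
  classical
  have : Module.Finite C S := Module.Finite.of_basis B.basis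
  choose f hfT hf using fun i : B.leads T => i.2
  have hval : ∀ (i : B.leads T) (k : C), B.valuation (k • f i) =
      v (k * B.basis.repr (f i) i) * B.value i := fun i k => by
    rw [valuation_smul, valuation_apply, (hf i).2.1, map_mul, mul_assoc]
  have hli : LinearIndependent C f := by
    refine B.valuation.linearIndependent_of_injective f (fun i k hk => ?_)
      fun i j k l hk hl h => ?_
    · rw [Ne, valuation_eq_zero, smul_eq_zero, not_or]
      exact ⟨hk, (hf i).ne_zero⟩
    · rw [hval, hval] at h
      exact Subtype.ext (B.separated _ _ _ _ (mul_ne_zero hk (hf i).1)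
        (mul_ne_zero hl (hf j).1) h)
  let g : B.leads T → T := fun i => ⟨f i, hfT i⟩
  have hg : LinearIndependent C g := LinearIndependent.of_comp T.val.toLinearMap hli
  -- Upper bound for `dim T`: a nonzero element has a nonzero coordinate at its own dominant degree,
  -- so the coordinates in `leads T` determine it.
  let φ : T →ₗ[C] (B.leads T → C) := LinearMap.pi fun i => (B.basis.coord i).comp T.val.toLinearMap
  have hφ : Function.Injective φ := by
    rw [← LinearMap.ker_eq_bot, LinearMap.ker_eq_bot']
    intro t ht
    by_contra h
    obtain ⟨i, hi⟩ := B.exists_isLead (s := (t : S)) (by simpa using h)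
    exact hi.1 (congrFun ht ⟨i, t, t.2, hi⟩)
  have hcard : Fintype.card (B.leads T) = Module.finrank C T := by
    apply le_antisymm hg.fintype_card_le_finrank
    simpa using LinearMap.finrank_le_finrank_of_injective hφ
  by_cases hne : Nonempty (B.leads T)
  · exact ⟨basisOfLinearIndependentOfCardEqFinrank hg hcard, fun i => by simpa [g] using hf i⟩
  · exact absurd ⟨⟨0, 1, T.one_mem, B.isLead_one⟩⟩ hne

/-- In a subalgebra with centre `C`, an element whose dominant monomial commutes with all dominant
monomials has degree zero. -/
theorem eq_zero_of_commute_leads (hcard : v (Fintype.card ι : C) = 1) {T : Subalgebra C S}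
    (hT : Subalgebra.center C T = ⊥) {i : ι} (hi : i ∈ B.leads T)
    (hc : ∀ j ∈ B.leads T, Commute (B.basis i) (B.basis j)) : i = 0 := by
  classical
  have := B.isDomain
  obtain ⟨w, hw⟩ := B.exists_basis_leads T
  obtain ⟨a, haT, ha⟩ := hi
  let l : T →ₗ[C] C := B.constCoeff.comp T.val.toLinearMap
  have hl : ∀ s t, l (s * t) = l (t * s) := fun s t => B.constCoeff_mul_comm s t
  let β : LinearMap.BilinForm C T := (LinearMap.mul C T).compr₂ l
  have hβ : ∀ s t, β s t = l (s * t) := fun s t => rfl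
  have hβs : β.IsSymm := ⟨fun s t => hl s t⟩
  -- multiplying by a suitable basis vector brings any element to degree zero
  have key : ∀ u : T, u ≠ 0 → ∃ i, B.IsLead (w i * u : S) 0 := fun u hu => by
    obtain ⟨t, ht, -⟩ := B.exists_inverse T hu
    obtain ⟨j, hj⟩ := B.exists_isLead (s := (u : S)) (by simpa using hu)
    obtain ⟨k, hk⟩ := B.exists_isLead (s := (t : S)) (by
      rintro h
      rw [Subtype.ext (a1 := t) (a2 := 0) h, zero_mul] at ht
      exact hu (by rw [← one_mul u, ← ht, zero_mul]))
    have hkj := hk.mul hj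
    have : (t * u : S) = 1 := congrArg Subtype.val ht
    rw [this] at hkj
    refine ⟨⟨k, t, t.2, hk⟩, ?_⟩
    have := (hw ⟨k, t, t.2, hk⟩).mul hj
    rwa [hkj.unique B.isLead_one] at this
  have hβn : β.Nondegenerate := by
    refine (hβs.isRefl.nondegenerate_iff_separatingRight).mpr fun u hu => ?_
    by_contra h
    obtain ⟨i, hi⟩ := key u h
    refine hi.ne_zero ?_
    rw [← B.valuation_eq_zero, ← (hi.valuation_constCoeff).1]
    rw [show B.constCoeff (w i * u : S) = β (w i) u from rfl, hu, map_zero]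
  let u := β.dualBasis hβn w
  have huw : ∀ i j, l (w i * u j) = if i = j then 1 else 0 := fun i j => by
    rw [← hβ, LinearMap.BilinForm.apply_dualBasis_right hβn hβs]
  -- Some `w j * u i` has degree zero, so its constant coefficient is nonzero; duality then forces
  -- `j = i`.
  have hlead : ∀ i, B.IsLead (w i * u i : S) 0 := fun i => by
    obtain ⟨j, hj⟩ := key (u i) (u.ne_zero i)
    by_cases hji : j = i
    · rwa [hji] at hj
    · refine absurd ?_ hj.ne_zero
      rw [← B.valuation_eq_zero, ← (hj.valuation_constCoeff).1]
      rw [show B.constCoeff (w j * u i : S) = l (w j * u i) from rfl, huw, if_neg hji, map_zero]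
  have hcc : ∀ i, B.constCoeff (w i * u i : S) = 1 := fun i => by
    rw [show B.constCoeff (w i * u i : S) = l (w i * u i) from rfl, huw, if_pos rfl]
  have hval : ∀ i, B.valuation (w i * u i : S) = 1 := fun i => by
    rw [← (hlead i).valuation_constCoeff.1, hcc, map_one]
  have hsub : ∀ i, B.valuation (w i * u i - 1 : S) < 1 := fun i => by
    have := (hlead i).valuation_constCoeff.2
    rwa [hcc, map_one, hval] at this
  let d := Fintype.card (B.leads T)
  have hd : v (d : C) = 1 := by
    apply le_antisymm (v.map_natCast_le_one _)
    obtain ⟨e, he⟩ := B.finrank_dvd T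
    rw [Module.finrank_eq_card_basis w] at he
    rw [← hcard, he, Nat.cast_mul, map_mul]
    exact mul_le_of_le_one_right' (v.map_natCast_le_one _)
  -- The Casimir average of `a`: central in `T`, hence a scalar `c`.
  let z : T := ∑ i, w i * ⟨a, haT⟩ * u i
  have hz : z ∈ Subalgebra.center C T := by
    rw [Subalgebra.mem_center_iff]
    intro y
    refine (commute_sum_mul_mul_of_dual l hl w u (fun z i => ?_) (fun z i => ?_) _ y).symm.eq
    · have h : l ((∑ j, w.repr z j • w j) * u i) = w.repr z i := by
        simp only [Finset.sum_mul, smul_mul_assoc, map_sum, map_smul, huw, smul_eq_mul, mul_ite,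
          mul_one, mul_zero, Finset.sum_ite_eq', Finset.mem_univ, if_true]
      rw [w.sum_repr] at h
      exact h.symm
    · exact LinearMap.BilinForm.dualBasis_repr_apply hβn w z i
  rw [hT, Algebra.mem_bot] at hz
  obtain ⟨c, hc'⟩ := hz
  have hzS : algebraMap C S c = ∑ i, (w i * a * u i : S) := by
    have := congrArg T.val hc'
    simpa [z] using this
  have ha0 : 0 < B.valuation a := zero_lt_iff.mpr (by rw [Ne, valuation_eq_zero]; exact ha.ne_zero)
  -- Each `w i * a * u i` is close to `a`: `w i` and `a` commute up to smaller terms, and `w i * u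
  -- i` is `1` up to smaller terms. Hence `c` has the value of `d • a`, which is that of `a`.
  have hdiff : B.valuation (algebraMap C S c - (d : C) • a) < B.valuation a := by
    have : algebraMap C S c - (d : C) • a =
        ∑ i, ((w i * a - a * w i) * u i + a * (w i * u i - 1) : S) := by
      rw [hzS]
      have : ∀ i, ((w i * a - a * w i) * u i + a * (w i * u i - 1) : S) = w i * a * u i - a :=
        fun i => by noncomm_ring
      simp only [this, Finset.sum_sub_distrib]
      simp [d, Nat.cast_smul_eq_nsmul]
    rw [this]
    refine Valuation.map_sum_lt _ ha0.ne' fun i _ => Valuation.map_add_lt _ ?_ ?_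
    · have h1 := B.valuation_commutator_lt (hw i) ha (hc i i.2).symm
      have h2 := hval i
      rw [map_mul] at h2 ⊢
      have h3 : 0 < B.valuation (u i : S) := zero_lt_iff.mpr (right_ne_zero_of_mul_eq_one h2)
      calc _ < B.valuation (w i : S) * B.valuation a * B.valuation (u i : S) :=
            mul_lt_mul_of_pos_right h1 h3
        _ = _ := by rw [mul_right_comm, h2, one_mul]
    · rw [map_mul]
      calc _ < B.valuation a * 1 := mul_lt_mul_of_pos_left (hsub i) ha0
        _ = _ := mul_one _
  have hca : v c = B.valuation a := by
    rw [← B.valuation_algebraMap]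
    have h1 : B.valuation ((d : C) • a) = B.valuation a := by rw [valuation_smul, hd, one_mul]
    rw [← h1] at hdiff ⊢
    exact Valuation.map_eq_of_sub_lt _ hdiff
  have hc0 : c ≠ 0 := by
    rintro rfl
    rw [map_zero] at hca
    exact ha0.ne hca
  refine ha.unique (B.isLead_of_norm_eq hc0 ?_)
  rw [value_zero, mul_one, hca]

/-- If `n • i = 0` forces commutation of smaller multiples, a subalgebra with centre `C` is
trivial. -/
theorem eq_bot_of_center_eq_bot (hcard : v (Fintype.card ι : C) = 1) {p M : ℕ}
    (hM : ∀ i : ι, p ^ M • i = 0)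
    (hcomm : ∀ k (i j : ι), p ^ (k + 1) • i = 0 → p ^ (k + 1) • j = 0 →
      Commute (B.basis (p ^ k • i)) (B.basis j))
    {T : Subalgebra C S} (hT : Subalgebra.center C T = ⊥) : T = ⊥ := by
  -- Descent on the exponent: `p ^ k • i` is the degree of a `p ^ k`-th power, so it is again in
  -- `leads T`, and it commutes with all of them.
  have hdesc : ∀ k, (∀ i ∈ B.leads T, p ^ k • i = 0) → ∀ i ∈ B.leads T, i = 0 := by
    intro k
    induction k with
    | zero => intro h i hi; simpa using h i hi
    | succ k ih =>
      intro h
      refine ih fun i hi => B.eq_zero_of_commute_leads hcard hT ?_ fun j hj =>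
        hcomm k i j (h i hi) (h j hj)
      obtain ⟨t, ht, hti⟩ := hi
      exact ⟨t ^ p ^ k, pow_mem ht _, hti.pow _⟩
  have hzero := hdesc M fun i _ => hM i
  rw [eq_bot_iff]
  intro s hs
  rw [Algebra.mem_bot]
  -- Subtracting its constant coefficient leaves an element of `T` that, if nonzero, would have
  -- degree zero and yet no constant term.
  refine ⟨B.constCoeff s, ?_⟩
  by_contra h
  have hmem : s - algebraMap C S (B.constCoeff s) ∈ T := sub_mem hs (T.algebraMap_mem _)
  obtain ⟨i, hi⟩ := B.exists_isLead (sub_ne_zero.mpr (Ne.symm h))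
  obtain rfl := hzero i ⟨_, hmem, hi⟩
  refine hi.1 ?_
  change B.constCoeff _ = 0
  rw [map_sub, constCoeff_algebraMap, sub_self]

end MonomialBasis

/-! ### A valuation on `L` from Hahn series. -/

namespace HahnSeries

theorem prod_single_one {Γ R κ : Type*} [AddCommMonoid Γ] [PartialOrder Γ]
    [IsOrderedCancelAddMonoid Γ] [CommSemiring R] (t : Finset κ) (g : κ → Γ) :
    ∏ s ∈ t, single (g s) (1 : R) = single (∑ s ∈ t, g s) 1 := by
  classical
  induction t using Finset.induction_on with
  | empty => simp
  | insert a t ha ih => rw [Finset.prod_insert ha, ih, Finset.sum_insert ha, single_mul_single,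
      one_mul]

section Monomials

variable {σ K : Type*} [LinearOrder σ] [Field K] (e : σ → ℕ)

/-- The substitution of monomial Hahn series with exponents `e` for the variables. -/
noncomputable def ofMvPolynomial : MvPolynomial σ K →ₐ[K] HahnSeries (Lex (σ → ℤ)) K :=
  MvPolynomial.aeval fun s => single (toLex (Pi.single s (e s : ℤ))) 1

theorem ofMvPolynomial_X (s : σ) :
    ofMvPolynomial (K := K) e (MvPolynomial.X s) = single (toLex (Pi.single s (e s : ℤ))) 1 := by
  rw [ofMvPolynomial, MvPolynomial.aeval_X]

variable [Fintype σ]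

theorem ofMvPolynomial_eq (P : MvPolynomial σ K) : ofMvPolynomial e P =
    ∑ d ∈ P.support, single (toLex fun s => (e s : ℤ) * d s) (P.coeff d) := by
  conv_lhs => rw [P.as_sum, map_sum]
  refine Finset.sum_congr rfl fun d _ => ?_
  have hexp : ∑ s, (d s) • toLex (Pi.single s (e s : ℤ)) =
      toLex fun s => (e s : ℤ) * d s := by
    apply ofLex.injective
    funext s
    rw [show ofLex (∑ s, (d s) • toLex (Pi.single s (e s : ℤ))) =
      ∑ s, (d s) • (Pi.single s (e s : ℤ) : σ → ℤ) from rfl, Finset.sum_apply]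
    simp [Pi.single_apply, mul_comm]
  rw [ofMvPolynomial, MvPolynomial.aeval_monomial, Finsupp.prod_fintype _ _ (by simp)]
  simp only [single_pow, one_pow]
  rw [prod_single_one, hexp, ← C_eq_algebraMap, C_apply, single_mul_single, zero_add, mul_one]

theorem coeff_ofMvPolynomial (he : ∀ s, e s ≠ 0) (P : MvPolynomial σ K) (d : σ →₀ ℕ) :
    (ofMvPolynomial e P).coeff (toLex fun s => (e s : ℤ) * d s) = P.coeff d := by
  classical
  rw [ofMvPolynomial_eq, coeff_sum, Finset.sum_eq_single d]
  · simp
  · intro d' _ hd'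
    refine coeff_single_of_ne fun h => hd' ?_
    ext s
    have := congrFun (toLex.injective h) s
    simpa [he s] using this.symm
  · intro h
    simpa using h

theorem ofMvPolynomial_injective (he : ∀ s, e s ≠ 0) :
    Function.Injective (ofMvPolynomial (K := K) e) := by
  intro P Q h
  ext d
  rw [← coeff_ofMvPolynomial e he, h, coeff_ofMvPolynomial e he]

/-- The order is an exponent in the support, and all exponents there are multiples of `e`
coordinatewise. -/
theorem exists_order_ofMvPolynomial {P : MvPolynomial σ K} (hP : ofMvPolynomial e P ≠ 0) :
    ∃ a : σ → ℤ, (ofMvPolynomial e P).order = toLex fun s => (e s : ℤ) * a s := by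
  have h := coeff_order_eq_zero.not.mpr hP
  rw [ofMvPolynomial_eq, coeff_sum] at h
  obtain ⟨d, -, hd⟩ := Finset.exists_ne_zero_of_sum_ne_zero h
  refine ⟨fun s => d s, ?_⟩
  rw [← ofMvPolynomial_eq] at hd
  by_contra hne
  exact hd (coeff_single_of_ne hne)

end Monomials

/-- A purely transcendental extension embeds into Hahn series with prescribed monomials as images
of the variables. -/
theorem exists_ringHom_of_algebraicIndependent {σ K C : Type*} [LinearOrder σ] [Fintype σ]
    [Field K] [Field C] [Algebra K C] (x : σ → C) (hx : AlgebraicIndependent K x)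
    (hC : IntermediateField.adjoin K (Set.range x) = ⊤) (e : σ → ℕ) (he : ∀ s, e s ≠ 0) :
    ∃ f : C →+* HahnSeries (Lex (σ → ℤ)) K,
      (∀ k, f (algebraMap K C k) = HahnSeries.C k) ∧
      (∀ s, f (x s) = single (toLex (Pi.single s (e s : ℤ))) 1) ∧
      ∀ c, c ≠ 0 → ∃ a : σ → ℤ, (f c).order = toLex fun s => (e s : ℤ) * a s := by
  let ψ : FractionRing (MvPolynomial σ K) ≃ₐ[K] C :=
    (hx.aevalEquivField.trans (IntermediateField.equivOfEq hC)).trans IntermediateField.topEquiv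
  have hψ : ∀ P : MvPolynomial σ K, ψ (algebraMap _ _ P) = MvPolynomial.aeval x P :=
    fun P => hx.aevalEquivField_algebraMap_apply_coe P
  let g : FractionRing (MvPolynomial σ K) →ₐ[K] HahnSeries (Lex (σ → ℤ)) K :=
    IsFractionRing.liftAlgHom (ofMvPolynomial_injective e he)
  have hg : ∀ P : MvPolynomial σ K, g (algebraMap _ _ P) = ofMvPolynomial e P :=
    fun P => IsFractionRing.lift_algebraMap (ofMvPolynomial_injective e he) P
  refine ⟨(g.comp ψ.symm.toAlgHom).toRingHom, fun k => ?_, fun s => ?_, fun c hc => ?_⟩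
  · exact ((g.comp ψ.symm.toAlgHom).commutes k).trans (DFunLike.congr_fun C_eq_algebraMap k).symm
  · rw [← ofMvPolynomial_X, ← hg]
    change g (ψ.symm (x s)) = _
    congr 1
    rw [AlgEquiv.symm_apply_eq, hψ, MvPolynomial.aeval_X]
  · obtain ⟨P, Q, hQ, hPQ⟩ := IsFractionRing.div_surjective (A := MvPolynomial σ K) (ψ.symm c)
    have hc' : g (ψ.symm c) ≠ 0 := by simpa using hc
    change ∃ a : σ → ℤ, (g (ψ.symm c)).order = _
    have hQ0 : ofMvPolynomial e Q ≠ 0 := by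
      rw [Ne, map_eq_zero_iff _ (ofMvPolynomial_injective e he)]
      exact nonZeroDivisors.ne_zero hQ
    have hmul : g (ψ.symm c) * ofMvPolynomial e Q = ofMvPolynomial e P := by
      rw [← hPQ, map_div₀, hg, hg, div_mul_cancel₀ _ hQ0]
    have hP0 : ofMvPolynomial e P ≠ 0 := hmul ▸ mul_ne_zero hc' hQ0
    obtain ⟨a, ha⟩ := exists_order_ofMvPolynomial e hP0
    obtain ⟨b, hb⟩ := exists_order_ofMvPolynomial e hQ0
    have := order_mul hc' hQ0
    rw [hmul, ha, hb] at this
    refine ⟨a - b, ?_⟩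
    rw [eq_comm, ← eq_sub_iff_add_eq] at this
    rw [this]
    apply ofLex.injective
    funext s
    exact (mul_sub _ _ _).symm

end HahnSeries

/-- The monomial values of the `orderTop` valuation of Hahn series, written multiplicatively. -/
def HahnSeries.lexValue (σ : Type*) [LinearOrder σ] :
    Multiplicative (σ → ℤ) →* Multiplicative (WithTop (Lex (σ → ℤ)))ᵒᵈ where
  toFun a := Multiplicative.ofAdd (OrderDual.toDual ((toLex a.toAdd : Lex (σ → ℤ)) :
    WithTop (Lex (σ → ℤ))))
  map_one' := rfl
  map_mul' _ _ := rfl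

open HahnSeries in
/-- A field generated by `p`-th roots of some of the variables of a purely transcendental extension
carries a valuation with independent prescribed values on the variables. -/
theorem exists_valuation_of_adjoin_roots {σ τ : Type} {K C L : Type*} [Finite σ] [DecidableEq σ]
    [Field K] [Field C] [Algebra K C] (x : σ → C) (hx : AlgebraicIndependent K x)
    (hC : IntermediateField.adjoin K (Set.range x) = ⊤) (e : σ → ℕ) (he : ∀ s, e s ≠ 0)
    [Field L] [Algebra C L] {p : ℕ} (hp : p ≠ 0) {ζ : K} (hζ : IsPrimitiveRoot ζ p)
    (i : τ → σ) (t : τ → L) (ht : ∀ j, t j ^ p = algebraMap C L (x (i j)))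
    (hL : IntermediateField.adjoin C (Set.range t) = ⊤) (N : τ → ℕ) (hN : ∀ j, e (i j) = p * N j) :
    ∃ (Γ₀ : Type) (_ : LinearOrderedCommGroupWithZero Γ₀) (v : Valuation L Γ₀)
      (val : Multiplicative (σ → ℤ) →* Γ₀), Function.Injective val ∧
      (∀ k : K, k ≠ 0 → v (algebraMap C L (algebraMap K C k)) = 1) ∧
      (∀ s, v (algebraMap C L (x s)) = val (Multiplicative.ofAdd (Pi.single s (e s : ℤ)))) ∧
      (∀ j, v (t j) = val (Multiplicative.ofAdd (Pi.single (i j) (N j : ℤ)))) ∧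
      ∀ c : C, c ≠ 0 → ∃ a : σ → ℤ,
        v (algebraMap C L c) = val (Multiplicative.ofAdd fun s => (e s : ℤ) * a s) := by
  have := Fintype.ofFinite σ
  -- Any order on the variables will do; it only serves to order exponents lexicographically.
  let _ : LinearOrder σ := LinearOrder.lift' (Finite.equivFin σ) (Equiv.injective _)
  obtain rfl := Subsingleton.elim ‹DecidableEq σ› LinearOrder.toDecidableEq
  obtain ⟨f, hfK, hfx, hfc⟩ := exists_ringHom_of_algebraicIndependent x hx hC e he
  let _ : Algebra C (HahnSeries (Lex (σ → ℤ)) K) := f.toAlgebra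
  have hroot : ∀ j, (single (toLex (Pi.single (i j) (N j : ℤ))) (1 : K) :
      HahnSeries (Lex (σ → ℤ)) K) ^ p = f (x (i j)) := fun j => by
    rw [hfx, single_pow, one_pow, hN]
    congr 2
    apply ofLex.injective
    rw [show ofLex (p • toLex (Pi.single (i j) (N j : ℤ) : σ → ℤ)) = p • Pi.single (i j) (N j : ℤ)
      from rfl, ← Pi.single_smul]
    simp
  -- The Hahn series contain one monomial `p`-th root of each image and all `p`-th roots of unity,
  -- so the polynomials of the `t j` split and `L` embeds.
  obtain ⟨g⟩ : Nonempty (L →ₐ[C] HahnSeries (Lex (σ → ℤ)) K) := by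
    refine IntermediateField.nonempty_algHom_of_adjoin_splits ?_ hL
    rintro _ ⟨j, rfl⟩
    have hmonic : (Polynomial.X ^ p - Polynomial.C (x (i j))).Monic :=
      Polynomial.monic_X_pow_sub_C _ hp
    have hev : Polynomial.aeval (t j) (Polynomial.X ^ p - Polynomial.C (x (i j))) = 0 := by
      simp [ht]
    refine ⟨⟨_, hmonic, hev⟩, ?_⟩
    have hsplit : (Polynomial.X ^ p - Polynomial.C (f (x (i j)))).Splits :=
      X_pow_sub_C_splits_of_isPrimitiveRoot (hζ.map_of_injective
        (f := (HahnSeries.C : K →+* HahnSeries (Lex (σ → ℤ)) K)) HahnSeries.C_injective) (hroot j)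
    have hmap : (Polynomial.X ^ p - Polynomial.C (x (i j))).map f =
      Polynomial.X ^ p - Polynomial.C (f (x (i j))) := by simp
    refine (hmap ▸ hsplit).of_dvd ((Polynomial.map_ne_zero_iff f.injective).mpr hmonic.ne_zero) ?_
    exact Polynomial.map_dvd _ (minpoly.dvd _ _ hev)
  have hgf : ∀ c, g (algebraMap C L c) = f c := g.commutes
  let w : Valuation (HahnSeries (Lex (σ → ℤ)) K) (Multiplicative (WithTop (Lex (σ → ℤ)))ᵒᵈ) :=
    (addVal (Lex (σ → ℤ)) K).toValuation
  have hw : ∀ h (a : σ → ℤ), h ≠ 0 → h.order = toLex a →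
      w h = lexValue σ (Multiplicative.ofAdd a) := fun h a hh ha => by
    rw [AddValuation.toValuation_apply, addVal_apply_of_ne hh, ha]
    rfl
  have hws : ∀ (a : σ → ℤ) (r : K), r ≠ 0 →
      w (single (toLex a) r) = lexValue σ (Multiplicative.ofAdd a) := fun a r hr =>
    hw _ _ (by simpa using hr) (order_single hr)
  refine ⟨_, inferInstance, w.comap g.toRingHom, lexValue σ, ?_, ?_, ?_, ?_, ?_⟩
  · intro a b hab
    exact congrArg Multiplicative.ofAdd (WithTop.coe_injective hab)
  · intro k hk
    change w (g (algebraMap C L _)) = 1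
    rw [hgf, hfK]
    exact (hws 0 k hk).trans (map_one _)
  · intro s
    change w (g (algebraMap C L _)) = _
    rw [hgf, hfx]
    exact hws _ _ one_ne_zero
  · intro j
    -- `g (t j)` may differ from the monomial root by a root of unity, so only `p`-th powers are
    -- compared.
    have h1 : w (g (t j)) ^ p =
        (lexValue σ (Multiplicative.ofAdd (Pi.single (i j) (N j : ℤ)))) ^ p := by
      rw [← map_pow, ← map_pow, ht, hgf, ← hroot, map_pow, hws _ _ one_ne_zero]
    exact (pow_left_inj₀ zero_le zero_le hp).mp h1
  · intro c hc
    obtain ⟨a, ha⟩ := hfc c hc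
    refine ⟨a, ?_⟩
    change w (g (algebraMap C L _)) = _
    rw [hgf]
    exact hw _ _ (by simpa using hc) ha

/-! ### Eigenvectors of conjugations. -/

section Conjugation

variable {F A ι κ : Type*} [Field F] [Ring A] [Algebra F A] {u : κ → A} {χ : κ → ι → F}

/-- Simultaneous eigenvectors of conjugations with distinct characters are independent. -/
theorem linearIndependent_of_conj {s : ι → A} (h : ∀ k i, u k * s i = χ k i • (s i * u k))
    (hu : ∀ k, IsUnit (u k)) (hs : ∀ i, s i ≠ 0) (hχ : ∀ i j, (∀ k, χ k i = χ k j) → i = j) :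
    LinearIndependent F s := by
  classical
  rw [linearIndependent_iff']
  intro t
  induction t using Finset.induction_on with
  | empty => simp
  | insert a t ha ih =>
    intro g hg
    have hk : ∀ k, ∑ i ∈ insert a t, (g i * χ k i) • s i = 0 := fun k => by
      refine (hu k).mul_left_eq_zero.mp ?_
      have := congrArg (u k * ·) hg
      simp only [Finset.mul_sum, mul_zero, mul_smul_comm, h, smul_smul] at this
      simpa only [Finset.sum_mul, smul_mul_assoc] using this
    have ht : ∀ i ∈ t, g i = 0 := by
      intro i hi
      by_contra hgi
      have hia : i ≠ a := fun e => ha (e ▸ hi)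
      refine hia (hχ _ _ fun k => ?_)
      -- Subtracting `χ k a` times the relation from its conjugate eliminates the term at `a`, as in
      -- Dedekind's independence of characters.
      have h1 : ∑ i ∈ t, (g i * (χ k i - χ k a)) • s i = 0 := by
        have h2 := hk k
        have h3 := congrArg (χ k a • ·) hg
        simp only [Finset.smul_sum, smul_zero, smul_smul] at h3
        have h4 : ∑ i ∈ insert a t, (g i * (χ k i - χ k a)) • s i = 0 := by
          simp only [mul_sub, sub_smul, Finset.sum_sub_distrib, h2, zero_sub, neg_eq_zero]
          simpa only [mul_comm] using h3
        rwa [Finset.sum_insert ha, sub_self, mul_zero, zero_smul, zero_add] at h4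
      exact sub_eq_zero.mp ((mul_eq_zero.mp (ih _ h1 i hi)).resolve_left hgi)
    intro i hi
    rcases Finset.mem_insert.mp hi with rfl | hi
    · rw [Finset.sum_insert ha, Finset.sum_eq_zero (fun j hj => by rw [ht j hj, zero_smul]),
        add_zero, smul_eq_zero] at hg
      exact hg.resolve_right (hs i)
    · exact ht i hi

/-- An algebra graded by characters of conjugations has as centre the trivial component. -/
theorem center_eq_bot_of_conj [Fintype ι] (B : Module.Basis ι F A)
    (h : ∀ k i, u k * B i = χ k i • (B i * u k)) (hu : ∀ k, IsUnit (u k)) (i₀ : ι) (h₀ : B i₀ = 1)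
    (hχ : ∀ i, (∀ k, χ k i = 1) → i = i₀) : Subalgebra.center F A = ⊥ := by
  classical
  rw [eq_bot_iff]
  intro z hz
  rw [Subalgebra.mem_center_iff] at hz
  have hzi : ∀ i, i ≠ i₀ → B.repr z i = 0 := by
    intro i hi
    by_contra hne
    refine hi (hχ i fun k => ?_)
    have h1 : ∑ i, (B.repr z i * χ k i - B.repr z i) • B i = 0 := by
      refine (hu k).mul_left_eq_zero.mp ?_
      have h2 := hz (u k)
      rw [← B.sum_repr z] at h2
      simp only [Finset.mul_sum, Finset.sum_mul, mul_smul_comm, h, smul_smul,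
        smul_mul_assoc] at h2
      simp only [Finset.sum_mul, sub_smul, smul_mul_assoc, Finset.sum_sub_distrib, sub_mul]
      rw [h2, sub_self]
    have h2 := Fintype.linearIndependent_iff.mp B.linearIndependent _ h1 i
    rw [← mul_sub_one] at h2
    exact sub_eq_zero.mp ((mul_eq_zero.mp h2).resolve_left hne)
  rw [Algebra.mem_bot]
  refine ⟨B.repr z i₀, ?_⟩
  rw [Algebra.algebraMap_eq_smul_one, ← h₀]
  conv_rhs => rw [← B.sum_repr z]
  exact (Finset.sum_eq_single (f := fun i => B.repr z i • B i) i₀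
    (fun i _ hi => by simp only [hzi i hi, zero_smul]) (by simp)).symm

end Conjugation

/-! ### Basis and centre of a symbol algebra. -/

namespace SymbolAlgebra

variable {F : Type*} [Field F] {a b ζ : F} {N : ℕ}

/-- The monomial `ξ ^ i * η ^ k`. -/
noncomputable def monomial (a b ζ : F) (N : ℕ) (i k : ℕ) : SymbolAlgebra a b ζ N :=
  RingQuot.mkAlgHom F (Rel a b ζ N) (FreeAlgebra.ι F 0) ^ i *
    RingQuot.mkAlgHom F (Rel a b ζ N) (FreeAlgebra.ι F 1) ^ k

theorem monomial_zero : monomial a b ζ N 0 0 = 1 := by simp [monomial]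

theorem monomial_mul (i k i' k' : ℕ) : monomial a b ζ N i k * monomial a b ζ N i' k' =
    ζ ^ (k * i') • monomial a b ζ N (i + i') (k + k') := by
  unfold monomial
  set ξ := RingQuot.mkAlgHom F (Rel a b ζ N) (FreeAlgebra.ι F 0)
  set η := RingQuot.mkAlgHom F (Rel a b ζ N) (FreeAlgebra.ι F 1)
  have h1 : η * ξ = ζ • (ξ * η) := by
    simpa [ξ, η] using RingQuot.mkAlgHom_rel F (Rel.comm (a := a) (b := b) (ζ := ζ) (N := N))
  have h2 : ∀ k, η ^ k * ξ = ζ ^ k • (ξ * η ^ k) := fun k => by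
    induction k with
    | zero => simp
    | succ k ih =>
      rw [pow_succ η, mul_assoc, h1, mul_smul_comm, ← mul_assoc, ih, smul_mul_assoc, smul_smul,
        mul_assoc, ← pow_succ']
  have h3 : ∀ k i, η ^ k * ξ ^ i = ζ ^ (k * i) • (ξ ^ i * η ^ k) := fun k i => by
    induction i with
    | zero => simp
    | succ i ih =>
      rw [pow_succ ξ, ← mul_assoc, ih, smul_mul_assoc, mul_assoc, h2, mul_smul_comm, smul_smul,
        ← mul_assoc, mul_add_one, pow_add]
  calc ξ ^ i * η ^ k * (ξ ^ i' * η ^ k') = ξ ^ i * (η ^ k * ξ ^ i') * η ^ k' := by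
        simp only [mul_assoc]
    _ = _ := by
      rw [h3, mul_smul_comm, smul_mul_assoc, pow_add, pow_add]
      simp only [mul_assoc]

theorem monomial_add (i k i' k' : ℕ) : monomial a b ζ N (i + N * i') (k + N * k') =
    (a ^ i' * b ^ k') • monomial a b ζ N i k := by
  unfold monomial
  set ξ := RingQuot.mkAlgHom F (Rel a b ζ N) (FreeAlgebra.ι F 0)
  set η := RingQuot.mkAlgHom F (Rel a b ζ N) (FreeAlgebra.ι F 1)
  have h1 : ξ ^ N = algebraMap F _ a := by
    simpa [ξ] using RingQuot.mkAlgHom_rel F (Rel.xi_pow (a := a) (b := b) (ζ := ζ) (N := N))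
  have h2 : η ^ N = algebraMap F _ b := by
    simpa [η] using RingQuot.mkAlgHom_rel F (Rel.eta_pow (a := a) (b := b) (ζ := ζ) (N := N))
  rw [pow_add, pow_add, pow_mul, pow_mul, h1, h2, ← map_pow (algebraMap F _),
    ← map_pow (algebraMap F _), Algebra.algebraMap_eq_smul_one, Algebra.algebraMap_eq_smul_one,
    mul_smul_comm, smul_mul_assoc, mul_smul_comm, mul_one, mul_one, mul_smul_comm, smul_smul]

theorem isUnit_monomial (ha : a ≠ 0) (hb : b ≠ 0) (hN : N ≠ 0) (i k : ℕ) :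
    IsUnit (monomial a b ζ N i k) := by
  have key : ∀ (x : SymbolAlgebra a b ζ N) (c : F), c ≠ 0 → x ^ N = algebraMap F _ c →
      IsUnit x := fun x c hc hx =>
    (isUnit_pow_iff hN).mp (hx ▸ (IsUnit.mk0 c hc).map (algebraMap F _))
  refine (IsUnit.pow i (key _ a ha ?_)).mul (IsUnit.pow k (key _ b hb ?_))
  · simpa using RingQuot.mkAlgHom_rel F (Rel.xi_pow (a := a) (b := b) (ζ := ζ) (N := N))
  · simpa using RingQuot.mkAlgHom_rel F (Rel.eta_pow (a := a) (b := b) (ζ := ζ) (N := N))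

theorem span_monomial [NeZero N] : Submodule.span F
    (Set.range fun i : Fin N × Fin N => monomial a b ζ N i.1 i.2) = ⊤ := by
  set P := Submodule.span F (Set.range fun i : Fin N × Fin N => monomial a b ζ N i.1 i.2)
  have hmem : ∀ i k, monomial a b ζ N i k ∈ P := fun i k => by
    rw [← Nat.mod_add_div i N, ← Nat.mod_add_div k N, monomial_add]
    exact P.smul_mem _ (Submodule.subset_span ⟨(⟨i % N, Nat.mod_lt _ (NeZero.pos N)⟩,
      ⟨k % N, Nat.mod_lt _ (NeZero.pos N)⟩), rfl⟩)
  have hmul : ∀ i k, ∀ m ∈ P, monomial a b ζ N i k * m ∈ P := fun i k m hm => by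
    induction hm using Submodule.span_induction with
    | mem x hx =>
      obtain ⟨j, rfl⟩ := hx
      rw [monomial_mul]
      exact P.smul_mem _ (hmem _ _)
    | zero => simp
    | add x y _ _ hx hy => rw [mul_add]; exact P.add_mem hx hy
    | smul c x _ hx => rw [mul_smul_comm]; exact P.smul_mem _ hx
  have key : ∀ x : FreeAlgebra F (Fin 2), ∀ m ∈ P, RingQuot.mkAlgHom F (Rel a b ζ N) x * m ∈ P := by
    intro x
    induction x using FreeAlgebra.induction with
    | grade0 c =>
      intro m hm
      rw [AlgHom.commutes, ← Algebra.smul_def]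
      exact P.smul_mem _ hm
    | grade1 i =>
      intro m hm
      fin_cases i
      · simpa [monomial] using hmul 1 0 m hm
      · simpa [monomial] using hmul 0 1 m hm
    | mul x y hx hy => intro m hm; rw [map_mul, mul_assoc]; exact hx _ (hy _ hm)
    | add x y hx hy => intro m hm; rw [map_add, add_mul]; exact P.add_mem (hx _ hm) (hy _ hm)
  rw [eq_top_iff]
  rintro x -
  obtain ⟨x, rfl⟩ := RingQuot.mkAlgHom_surjective F (Rel a b ζ N) x
  have h1 : (1 : SymbolAlgebra a b ζ N) ∈ P := monomial_zero (a := a) (b := b) (ζ := ζ) (N := N) ▸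
    hmem 0 0
  simpa using key x 1 h1

/-- Symbol algebras act on functions on `ZMod N`, by multiplication and translation operators. -/
theorem nontrivial [NeZero N] (hζ : ζ ^ N = 1) : Nontrivial (SymbolAlgebra a b ζ N) := by
  let E := AlgebraicClosure F
  obtain ⟨α, hα⟩ := IsAlgClosed.exists_pow_nat_eq (algebraMap F E a) (NeZero.pos N)
  obtain ⟨β, hβ⟩ := IsAlgClosed.exists_pow_nat_eq (algebraMap F E b) (NeZero.pos N)
  let X : Module.End E (ZMod N → E) :=
    LinearMap.pi fun i => (α * algebraMap F E ζ ^ i.val) • LinearMap.proj i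
  let Y : Module.End E (ZMod N → E) := LinearMap.pi fun i => β • LinearMap.proj (i + 1)
  have hX : ∀ (k : ℕ) f i, (X ^ k) f i = (α * algebraMap F E ζ ^ i.val) ^ k * f i := fun k => by
    induction k with
    | zero => simp
    | succ k ih => intro f i; rw [pow_succ, Module.End.mul_apply, ih]; simp [X, pow_succ, mul_assoc]
  have hY : ∀ (k : ℕ) f i, (Y ^ k) f i = β ^ k * f (i + k) := fun k => by
    induction k with
    | zero => simp
    | succ k ih =>
      intro f i
      rw [pow_succ, Module.End.mul_apply, ih]
      simp [Y, pow_succ, mul_assoc, add_assoc]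
  have hζ' : algebraMap F E ζ ^ N = 1 := by rw [← map_pow, hζ, map_one]
  let φ : SymbolAlgebra a b ζ N →ₐ[F] Module.End E (ZMod N → E) :=
    RingQuot.liftAlgHom F ⟨FreeAlgebra.lift F ![X, Y], by
      intro x y hxy
      cases hxy with
      | comm =>
        refine LinearMap.ext fun f => funext fun i => ?_
        -- The wrap-around from `N - 1` to `0` is absorbed by `ζ ^ N = 1`.
        have h1 : algebraMap F E ζ ^ (i + 1).val = algebraMap F E ζ ^ (i.val + 1) := by
          rw [ZMod.val_add, ZMod.val_one_eq_one_mod, Nat.add_mod_mod, ← pow_eq_pow_mod _ hζ']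
        simp [X, Y, h1, Algebra.smul_def]
        ring
      | xi_pow =>
        refine LinearMap.ext fun f => funext fun i => ?_
        simp [hX, mul_pow, hα, ← pow_mul, mul_comm _ N, pow_mul _ N, hζ', Algebra.smul_def]
      | eta_pow =>
        refine LinearMap.ext fun f => funext fun i => ?_
        simp [hY, hβ, Algebra.smul_def]⟩
  exact φ.toRingHom.domain_nontrivial

theorem conj_monomial (hζ : ζ ≠ 0) (g h : ℕ × ℕ) :
    monomial a b ζ N g.1 g.2 * monomial a b ζ N h.1 h.2 = (ζ ^ (g.2 * h.1) / ζ ^ (h.2 * g.1)) •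
      (monomial a b ζ N h.1 h.2 * monomial a b ζ N g.1 g.2) := by
  rw [monomial_mul, monomial_mul, smul_smul, div_mul_cancel₀ _ (pow_ne_zero _ hζ),
    add_comm h.1, add_comm h.2]

/-- The standard basis of a symbol algebra. -/
theorem exists_basis [NeZero N] (ha : a ≠ 0) (hb : b ≠ 0) (hζ : IsPrimitiveRoot ζ N) :
    ∃ B : Module.Basis (Fin N × Fin N) F (SymbolAlgebra a b ζ N),
      ∀ i, B i = monomial a b ζ N i.1 i.2 := by
  have := nontrivial (a := a) (b := b) hζ.pow_eq_one
  have hζ0 : ζ ≠ 0 := hζ.ne_zero (NeZero.ne N)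
  have hli : LinearIndependent F
      fun i : Fin N × Fin N => monomial a b ζ N i.1 i.2 := by
    refine linearIndependent_of_conj (fun g i => conj_monomial hζ0 g (i.1, i.2))
      (fun g => isUnit_monomial ha hb (NeZero.ne N) _ _)
      (fun i => (isUnit_monomial ha hb (NeZero.ne N) _ _).ne_zero) fun i j h => ?_
    -- Conjugation by `η` detects the exponent of `ξ`, and conjugation by `ξ` that of `η`.
    have h1 := h (0, 1)
    have h2 := h (1, 0)
    simp only [one_mul, mul_zero, zero_mul, pow_zero, div_one, mul_one, one_div, inv_inj] at h1 h2
    exact Prod.ext (Fin.ext (hζ.pow_inj i.1.2 j.1.2 h1)) (Fin.ext (hζ.pow_inj i.2.2 j.2.2 h2))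
  exact ⟨Module.Basis.mk hli span_monomial.ge, fun i => by simp⟩

theorem center_eq_bot [NeZero N] (ha : a ≠ 0) (hb : b ≠ 0) (hζ : IsPrimitiveRoot ζ N) :
    Subalgebra.center F (SymbolAlgebra a b ζ N) = ⊥ := by
  obtain ⟨B, hB⟩ := exists_basis ha hb hζ
  refine center_eq_bot_of_conj B (u := fun g : ℕ × ℕ => monomial a b ζ N g.1 g.2)
    (fun g i => by rw [hB]; exact conj_monomial (hζ.ne_zero (NeZero.ne N)) g (i.1, i.2))
    (fun g => isUnit_monomial ha hb (NeZero.ne N) _ _) (0, 0)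
    (by rw [hB]; exact monomial_zero) fun i h => ?_
  have h1 := h (0, 1)
  have h2 := h (1, 0)
  simp only [one_mul, mul_zero, zero_mul, pow_zero, div_one, mul_one, one_div,
    inv_eq_one] at h1 h2
  exact Prod.ext (Fin.ext (hζ.pow_inj i.1.2 (NeZero.pos N) (by simpa using h1)))
    (Fin.ext (hζ.pow_inj i.2.2 (NeZero.pos N) (by simpa using h2)))

end SymbolAlgebra

/-! ### Tensor products of symbol algebras over `L`. -/

namespace SymbolAlgebra

variable {J L S : Type*} [Field L] {x t ζ : J → L} {N : J → ℕ}
  [Ring S] [Algebra L S]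
  (e : S ≃ₐ[L] ⨂[L] j : J, SymbolAlgebra (x j) (t j) (ζ j) (N j))

/-- The pure tensor of monomials. -/
noncomputable def tensorMonomial (g : J → ℕ × ℕ) : S :=
  e.symm (PiTensorProduct.tprod L fun j => monomial (x j) (t j) (ζ j) (N j) (g j).1 (g j).2)

theorem tensorMonomial_zero : tensorMonomial e 0 = 1 := by
  rw [tensorMonomial, ← map_one e.symm, PiTensorProduct.one_def]
  congr 2
  funext j
  exact monomial_zero

theorem isUnit_tensorMonomial (hx : ∀ j, x j ≠ 0) (ht : ∀ j, t j ≠ 0) (hN : ∀ j, N j ≠ 0)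
    (g : J → ℕ × ℕ) : IsUnit (tensorMonomial e g) := by
  refine IsUnit.map e.symm ?_
  refine IsUnit.map (PiTensorProduct.tprodMonoidHom L) (Pi.isUnit_iff.mpr fun j => ?_)
  exact isUnit_monomial (hx j) (ht j) (hN j) _ _

variable [Fintype J]

theorem tensorMonomial_mul (g h : J → ℕ × ℕ) : tensorMonomial e g * tensorMonomial e h =
    (∏ j, ζ j ^ ((g j).2 * (h j).1)) • tensorMonomial e (g + h) := by
  rw [tensorMonomial, tensorMonomial, ← map_mul, PiTensorProduct.tprod_mul_tprod, tensorMonomial,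
    ← map_smul, ← MultilinearMap.map_smul_univ]
  congr 2
  funext j
  exact monomial_mul _ _ _ _

theorem tensorMonomial_add (g h : J → ℕ × ℕ) :
    tensorMonomial e (fun j => ((g j).1 + N j * (h j).1, (g j).2 + N j * (h j).2)) =
    (∏ j, x j ^ (h j).1 * t j ^ (h j).2) • tensorMonomial e g := by
  rw [tensorMonomial, tensorMonomial, ← map_smul, ← MultilinearMap.map_smul_univ]
  congr 2
  funext j
  exact monomial_add _ _ _ _

theorem conj_tensorMonomial (hζ : ∀ j, ζ j ≠ 0) (g h : J → ℕ × ℕ) :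
    tensorMonomial e g * tensorMonomial e h =
      ((∏ j, ζ j ^ ((g j).2 * (h j).1)) / ∏ j, ζ j ^ ((h j).2 * (g j).1)) •
        (tensorMonomial e h * tensorMonomial e g) := by
  rw [tensorMonomial_mul, tensorMonomial_mul, smul_smul, div_mul_cancel₀, add_comm h]
  exact Finset.prod_ne_zero_iff.mpr fun j _ => pow_ne_zero _ (hζ j)

theorem exists_tensorBasis [∀ j, NeZero (N j)] (hx : ∀ j, x j ≠ 0) (ht : ∀ j, t j ≠ 0)
    (hζ : ∀ j, IsPrimitiveRoot (ζ j) (N j)) :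
    ∃ B : Module.Basis (∀ j, Fin (N j) × Fin (N j)) L S,
      ∀ i, B i = tensorMonomial e fun j => ((i j).1, (i j).2) := by
  choose B hB using fun j => exists_basis (hx j) (ht j) (hζ j)
  refine ⟨(Basis.piTensorProduct B).map e.symm.toLinearEquiv, fun i => ?_⟩
  rw [Module.Basis.map_apply, Basis.piTensorProduct_apply]
  simp only [hB]
  rfl

theorem center_tensor_eq_bot (e : S ≃ₐ[L] ⨂[L] j : J, SymbolAlgebra (x j) (t j) (ζ j) (N j))
    [∀ j, NeZero (N j)] (hx : ∀ j, x j ≠ 0) (ht : ∀ j, t j ≠ 0)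
    (hζ : ∀ j, IsPrimitiveRoot (ζ j) (N j)) : Subalgebra.center L S = ⊥ := by
  classical
  obtain ⟨B, hB⟩ := exists_tensorBasis e hx ht hζ
  refine center_eq_bot_of_conj B (u := tensorMonomial e)
    (fun g i => by rw [hB]; exact conj_tensorMonomial e (fun j => (hζ j).ne_zero (NeZero.ne _)) _ _)
    (isUnit_tensorMonomial e hx ht fun j => NeZero.ne _) (fun j => (0, 0))
    (by rw [hB]; exact tensorMonomial_zero e) fun i h => ?_
  funext j
  have h1 := h (Pi.single j (0, 1))
  have h2 := h (Pi.single j (1, 0))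
  rw [Finset.prod_eq_single j (fun k _ hk => by simp [hk]) (by simp),
    Finset.prod_eq_single j (fun k _ hk => by simp [hk]) (by simp)] at h1 h2
  simp only [Pi.single_eq_same, one_mul, mul_zero, zero_mul, pow_zero, div_one, mul_one, one_div,
    inv_eq_one] at h1 h2
  exact Prod.ext (Fin.ext ((hζ j).pow_inj (i j).1.2 (NeZero.pos _) (by simpa using h1)))
    (Fin.ext ((hζ j).pow_inj (i j).2.2 (NeZero.pos _) (by simpa using h2)))

/-- Each tensor factor embeds. -/
theorem single_injective [DecidableEq J] [∀ j, NeZero (N j)] (hx : ∀ j, x j ≠ 0)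
    (ht : ∀ j, t j ≠ 0) (hζ : ∀ j, IsPrimitiveRoot (ζ j) (N j)) (j : J) :
    Function.Injective ((e.symm : _ →ₐ[L] S).comp (PiTensorProduct.singleAlgHom
      (A := fun j => SymbolAlgebra (x j) (t j) (ζ j) (N j)) j)) := by
  obtain ⟨b, hb⟩ := exists_basis (hx j) (ht j) (hζ j)
  obtain ⟨B, hB⟩ := exists_tensorBasis e hx ht hζ
  set φ := ((e.symm : _ →ₐ[L] S).comp (PiTensorProduct.singleAlgHom
      (A := fun j => SymbolAlgebra (x j) (t j) (ζ j) (N j)) j))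
  have hφ : ∀ i, φ (b i) = B (Function.update (fun _ => (0, 0)) j i) := fun i => by
    rw [hB, hb]
    change e.symm (PiTensorProduct.tprod L _) = _
    rw [tensorMonomial]
    congr 2
    funext k
    by_cases hk : k = j
    · subst hk
      simp
    · simp [hk, monomial_zero]
  have hli : LinearIndependent L (φ ∘ b) := by
    rw [show φ ∘ b = B ∘ Function.update (fun _ => (0, 0)) j from funext hφ]
    exact B.linearIndependent.comp _ (Function.update_injective _ _)
  rw [injective_iff_map_eq_zero]
  intro z hz
  refine b.ext_elem fun i => ?_
  rw [← b.sum_repr z, map_sum] at hz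
  simp only [map_smul] at hz
  rw [Fintype.linearIndependent_iff.mp hli _ hz i]
  simp

end SymbolAlgebra

/-! ### The monomial basis of the tensor product over `C`. -/

namespace SymbolAlgebra

variable {J C L S : Type*} [Fintype J] [Field C] [Field L] [Algebra C L]
  {x t ζ : J → L} {N : J → ℕ} [Ring S] [Algebra L S] [Algebra C S] [IsScalarTower C L S]
  {Γ₀ : Type*} [LinearOrderedCommGroupWithZero Γ₀] {v : Valuation L Γ₀}
  {val : Multiplicative (J ⊕ J → ℤ) →* Γ₀}
  (e : S ≃ₐ[L] ⨂[L] j : J, SymbolAlgebra (x j) (t j) (ζ j) (N j))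

theorem tensorMonomial_add_base {xC yC : J → C} {p : ℕ} (hxC : ∀ j, x j = algebraMap C L (xC j))
    (ht : ∀ j, t j ^ p = algebraMap C L (yC j)) (g h : J → ℕ × ℕ) :
    tensorMonomial e (fun j => ((g j).1 + N j * (h j).1, (g j).2 + p * N j * (h j).2)) =
    (∏ j, xC j ^ (h j).1 * yC j ^ (h j).2) • tensorMonomial e g := by
  have := tensorMonomial_add e g fun j => ((h j).1, p * (h j).2)
  simp only [pow_mul, ht, hxC] at this
  rw [algebra_compatible_smul L]
  simp only [map_prod, map_mul, map_pow]
  rw [← this]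
  congr 1
  funext j
  simp only [mul_assoc, mul_left_comm]

theorem tensorMonomial_eq_mod {p : ℕ} {xC yC : J → C} (hxC : ∀ j, x j = algebraMap C L (xC j))
    (ht : ∀ j, t j ^ p = algebraMap C L (yC j)) (g : J → ℕ × ℕ) :
    tensorMonomial e g = (∏ j, xC j ^ ((g j).1 / N j) * yC j ^ ((g j).2 / (p * N j))) •
      tensorMonomial e fun j => ((g j).1 % N j, (g j).2 % (p * N j)) := by
  rw [← tensorMonomial_add_base e hxC ht _
    fun j => ((g j).1 / N j, (g j).2 / (p * N j))]
  simp only [Nat.mod_add_div]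

theorem valuation_prod_pow [DecidableEq J]
    (hvx : ∀ j, v (x j) = val (Multiplicative.ofAdd (Pi.single (Sum.inl j) (N j : ℤ))))
    (hvt : ∀ j, v (t j) = val (Multiplicative.ofAdd (Pi.single (Sum.inr j) (N j : ℤ))))
    (a b : J → ℕ) : v (∏ j, x j ^ a j * t j ^ b j) =
      val (Multiplicative.ofAdd (Sum.elim (fun j => (N j : ℤ) * a j) fun j => (N j : ℤ) * b j)) := by
  simp only [map_prod, map_mul, map_pow, hvx, hvt]
  simp only [← map_pow, ← map_mul, ← map_prod]
  congr 1
  apply Multiplicative.toAdd.injective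
  simp only [toAdd_prod, toAdd_mul, toAdd_pow, toAdd_ofAdd]
  funext s
  rw [Finset.sum_apply]
  rcases s with j | j <;>
    simp [Pi.single_apply, mul_comm]

/-- The exponent `q j` contributes `N j * q j` to the value, and `C` only has values divisible by `p
* N j` there; so distinct residues modulo `p` give distinct classes. -/
theorem linearIndependent_prod_pow [DecidableEq J] {p : ℕ} (hN : ∀ j, N j ≠ 0) (hval : Function.Injective val)
    (hvx : ∀ j, v (x j) = val (Multiplicative.ofAdd (Pi.single (Sum.inl j) (N j : ℤ))))
    (hvt : ∀ j, v (t j) = val (Multiplicative.ofAdd (Pi.single (Sum.inr j) (N j : ℤ))))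
    (hvc : ∀ c : C, c ≠ 0 → ∃ a : J ⊕ J → ℤ, v (algebraMap C L c) =
      val (Multiplicative.ofAdd fun s => ((Sum.elim N (fun j => p * N j) s : ℕ) : ℤ) * a s)) :
    LinearIndependent C fun q : J → Fin p => ∏ j, t j ^ (q j : ℕ) := by
  have hvq : ∀ q : J → Fin p, v (∏ j, t j ^ (q j : ℕ)) = val (Multiplicative.ofAdd
      (Sum.elim (fun j => (N j : ℤ) * (0 : ℕ)) fun j => (N j : ℤ) * (q j : ℕ))) := fun q => by
    rw [← valuation_prod_pow hvx hvt (fun _ => 0)]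
    simp
  have hval0 : ∀ a, val a ≠ 0 := fun a => ((Group.isUnit a).map val).ne_zero
  refine v.linearIndependent_of_injective _ (fun q k hk => ?_) fun q r k l hk hl h => ?_
  · obtain ⟨a, ha⟩ := hvc k hk
    rw [Algebra.smul_def, map_mul, hvq, ha]
    exact mul_ne_zero (hval0 _) (hval0 _)
  · obtain ⟨a, ha⟩ := hvc k hk
    obtain ⟨b, hb⟩ := hvc l hl
    rw [Algebra.smul_def, Algebra.smul_def, map_mul, map_mul, hvq, hvq, ha, hb, ← map_mul val,
      ← map_mul val] at h
    have h1 := Multiplicative.ofAdd.injective (hval h)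
    funext j
    have h2 := congrFun h1 (Sum.inr j)
    change ((p * N j : ℕ) : ℤ) * a (Sum.inr j) + (N j : ℤ) * (q j : ℕ) =
      ((p * N j : ℕ) : ℤ) * b (Sum.inr j) + (N j : ℤ) * (r j : ℕ) at h2
    have h3 : (p : ℤ) * a (Sum.inr j) + (q j : ℕ) = (p : ℤ) * b (Sum.inr j) + (r j : ℕ) := by
      have : (N j : ℤ) ≠ 0 := by exact_mod_cast hN j
      apply mul_left_cancel₀ this
      push_cast at h2
      linarith
    have h4 : ((q j : ℕ) : ℤ) % p = ((r j : ℕ) : ℤ) % p := by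
      have := congrArg (· % (p : ℤ)) h3
      simpa [Int.add_emod] using this
    rw [Int.emod_eq_of_lt (by positivity) (by exact_mod_cast (q j).2),
      Int.emod_eq_of_lt (by positivity) (by exact_mod_cast (r j).2)] at h4
    exact Fin.ext (by exact_mod_cast h4)

variable {p : ℕ} [NeZero p] [∀ j, NeZero (N j)]

theorem linearIndependent_tensorMonomial (hx0 : ∀ j, x j ≠ 0) (ht0 : ∀ j, t j ≠ 0)
    (hζ : ∀ j, IsPrimitiveRoot (ζ j) (N j))
    (hli : LinearIndependent C fun q : J → Fin p => ∏ j, t j ^ (q j : ℕ)) :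
    LinearIndependent C fun i : ∀ j, ZMod (N j) × ZMod (p * N j) =>
      tensorMonomial e fun j => ((i j).1.val, (i j).2.val) := by
  obtain ⟨B, hB⟩ := exists_tensorBasis e hx0 ht0 hζ
  have h := linearIndependent_smul hli B.linearIndependent
  have hlt : ∀ j (k : ZMod (p * N j)), k.val / N j < p := fun j k =>
    Nat.div_lt_of_lt_mul ((ZMod.val_lt k).trans_eq (mul_comm _ _))
  -- An exponent of `η` below `p * N j` splits as remainder plus `N j` times quotient; the quotient
  -- becomes a power of `t j`, which identifies the monomial with a member of the product family for
  -- the tower `C ⊆ L ⊆ S`.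
  let f : (∀ j, ZMod (N j) × ZMod (p * N j)) → (J → Fin p) × (∀ j, Fin (N j) × Fin (N j)) :=
    fun i => (fun j => ⟨(i j).2.val / N j, hlt j _⟩, fun j => (⟨(i j).1.val, ZMod.val_lt _⟩,
      ⟨(i j).2.val % N j, Nat.mod_lt _ (NeZero.pos _)⟩))
  have hf : Function.Injective f := by
    intro i i' h
    funext j
    have h1 := congrArg Fin.val (congrFun (congrArg Prod.fst h) j)
    have h2 := congrArg (fun z => (Prod.fst z).val) (congrFun (congrArg Prod.snd h) j)
    have h3 := congrArg (fun z => (Prod.snd z).val) (congrFun (congrArg Prod.snd h) j)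
    simp only [f] at h1 h2 h3
    refine Prod.ext (ZMod.val_injective _ h2) (ZMod.val_injective _ ?_)
    rw [← Nat.mod_add_div (i j).2.val (N j), h1, h3, Nat.mod_add_div]
  convert h.comp f hf using 1
  funext i
  have := tensorMonomial_add e (fun j => ((i j).1.val, (i j).2.val % N j))
    fun j => (0, (i j).2.val / N j)
  simp only [mul_zero, add_zero, Nat.mod_add_div, pow_zero, one_mul] at this
  rw [this, Function.comp_apply, hB]

variable [DecidableEq J]

/-- The `C`-span is stable under each `t j`, hence under `L`, and contains an `L`-basis. -/
theorem span_tensorMonomial_eq_top {xC yC : J → C} (hxC : ∀ j, x j = algebraMap C L (xC j))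
    (ht : ∀ j, t j ^ p = algebraMap C L (yC j)) (hx0 : ∀ j, x j ≠ 0) (ht0 : ∀ j, t j ≠ 0)
    (hζ : ∀ j, IsPrimitiveRoot (ζ j) (N j))
    (hL : IntermediateField.adjoin C (Set.range t) = ⊤) :
    Submodule.span C (Set.range fun i : ∀ j, ZMod (N j) × ZMod (p * N j) =>
      tensorMonomial e fun j => ((i j).1.val, (i j).2.val)) = ⊤ := by
  set P := Submodule.span C (Set.range fun i : ∀ j, ZMod (N j) × ZMod (p * N j) =>
      tensorMonomial e fun j => ((i j).1.val, (i j).2.val)) with hP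
  have hmem : ∀ g, tensorMonomial e g ∈ P := fun g => by
    rw [tensorMonomial_eq_mod e hxC ht]
    refine P.smul_mem _ (Submodule.subset_span ⟨fun j => ((g j).1, (g j).2), ?_⟩)
    simp only [ZMod.val_natCast]
  have htP : ∀ j, ∀ s ∈ P, t j • s ∈ P := fun j s hs => by
    induction hs using Submodule.span_induction with
    | mem s hs =>
      obtain ⟨i, rfl⟩ := hs
      have := tensorMonomial_add e (fun j => ((i j).1.val, (i j).2.val)) (Pi.single j (0, 1))
      rw [Finset.prod_eq_single j (fun k _ hk => by simp [hk]) (by simp)] at this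
      simp only [Pi.single_eq_same, pow_zero, pow_one, one_mul] at this
      simp only [← this]
      exact hmem _
    | zero => simp
    | add a b _ _ ha hb => rw [smul_add]; exact P.add_mem ha hb
    | smul c a _ ha => rw [smul_comm]; exact P.smul_mem _ ha
  have hLP : ∀ l : L, ∀ s ∈ P, l • s ∈ P := by
    have hint : ∀ s ∈ Set.range t, IsAlgebraic C s := by
      rintro _ ⟨j, rfl⟩
      refine IsIntegral.isAlgebraic (IsIntegral.of_pow (NeZero.pos p) ?_)
      rw [ht]
      exact isIntegral_algebraMap
    have hadj := IntermediateField.adjoin_toSubalgebra_of_isAlgebraic hint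
    rw [hL] at hadj
    intro l
    have hl : l ∈ Algebra.adjoin C (Set.range t) := by
      rw [← hadj]
      trivial
    induction hl using Algebra.adjoin_induction with
    | mem l hl => obtain ⟨j, rfl⟩ := hl; exact htP j
    | algebraMap c => intro s hs; rw [algebraMap_smul]; exact P.smul_mem _ hs
    | add a b _ _ ha hb => intro s hs; rw [add_smul]; exact P.add_mem (ha s hs) (hb s hs)
    | mul a b _ _ ha hb => intro s hs; rw [mul_smul]; exact ha _ (hb _ hs)
  obtain ⟨B, hB⟩ := exists_tensorBasis e hx0 ht0 hζ
  rw [eq_top_iff]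
  rintro s -
  rw [← B.sum_repr s]
  exact P.sum_mem fun i _ => hLP _ _ (hB i ▸ hmem _)

/-- The monomials form a basis of the tensor product of symbol algebras over the base field, which
is orthogonal for a valuation. -/
theorem exists_monomialBasis {xC yC ζC : J → C} (hxC : ∀ j, x j = algebraMap C L (xC j))
    (ht : ∀ j, t j ^ p = algebraMap C L (yC j)) (hx0 : ∀ j, x j ≠ 0) (ht0 : ∀ j, t j ≠ 0)
    (hζC : ∀ j, ζ j = algebraMap C L (ζC j))
    (hζ : ∀ j, IsPrimitiveRoot (ζ j) (N j))
    (hL : IntermediateField.adjoin C (Set.range t) = ⊤) (hval : Function.Injective val)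
    (hvζ : ∀ j, v (ζ j) = 1)
    (hvx : ∀ j, v (x j) = val (Multiplicative.ofAdd (Pi.single (Sum.inl j) (N j : ℤ))))
    (hvt : ∀ j, v (t j) = val (Multiplicative.ofAdd (Pi.single (Sum.inr j) (N j : ℤ))))
    (hvc : ∀ c : C, c ≠ 0 → ∃ a : J ⊕ J → ℤ, v (algebraMap C L c) =
      val (Multiplicative.ofAdd fun s => ((Sum.elim N (fun j => p * N j) s : ℕ) : ℤ) * a s)) :
    ∃ B : MonomialBasis (v.comap (algebraMap C L)) (∀ j, ZMod (N j) × ZMod (p * N j)) S,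
      ∀ i, B.basis i = tensorMonomial e fun j => ((i j).1.val, (i j).2.val) := by
  have hli := linearIndependent_tensorMonomial e hx0 ht0 hζ
    (linearIndependent_prod_pow (C := C) (p := p) (fun j => NeZero.ne _) hval hvx hvt hvc)
  let B := Module.Basis.mk hli (span_tensorMonomial_eq_top e hxC ht hx0 ht0 hζ hL).ge
  have hB : ∀ i, B i = tensorMonomial e fun j => ((i j).1.val, (i j).2.val) := fun i => by
    simp [B]
  have hval0 : ∀ a, val a ≠ 0 := fun a => ((Group.isUnit a).map val).ne_zero
  refine ⟨{
    basis := B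
    -- The first factor comes from moving `η` past `ξ`; the others are the carries when exponents
    -- are reduced modulo `N j` and `p * N j`.
    coef := fun i k => (∏ j, ζC j ^ ((i j).2.val * (k j).1.val)) *
      ∏ j, xC j ^ (((i j).1.val + (k j).1.val) / N j) *
        yC j ^ (((i j).2.val + (k j).2.val) / (p * N j))
    value := fun i => val (Multiplicative.ofAdd
      (Sum.elim (fun j => ((i j).1.val : ℤ)) fun j => ((i j).2.val : ℤ)))
    basis_zero := ?_
    basis_mul := ?_
    value_ne_zero := fun i => hval0 _
    map_coef := ?_
    separated := ?_ }, hB⟩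
  · rw [hB, ← tensorMonomial_zero e]
    congr 1
    funext j
    simp
  · intro i k
    rw [hB, hB, hB, tensorMonomial_mul, tensorMonomial_eq_mod e hxC ht, mul_smul,
      algebra_compatible_smul L (∏ j, ζC j ^ _)]
    simp only [map_prod, map_pow, hζC, Pi.add_apply, Prod.fst_add, Prod.snd_add, ZMod.val_add]
  · intro i k
    have h1 : algebraMap C L (∏ j, xC j ^ (((i j).1.val + (k j).1.val) / N j) *
        yC j ^ (((i j).2.val + (k j).2.val) / (p * N j))) =
        ∏ j, x j ^ (((i j).1.val + (k j).1.val) / N j) *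
          t j ^ (p * (((i j).2.val + (k j).2.val) / (p * N j))) := by
      simp only [map_prod, map_mul, map_pow, hxC, pow_mul, ht]
    rw [Valuation.comap_apply, map_mul, map_mul, h1, valuation_prod_pow hvx hvt]
    simp only [map_prod, map_pow, ← hζC, hvζ, one_pow, Finset.prod_const_one, one_mul]
    rw [← map_mul val, ← map_mul val, ← ofAdd_add, ← ofAdd_add]
    congr 2
    funext s
    rcases s with j | j
    · simp only [Pi.add_apply, Sum.elim_inl, Prod.fst_add, ZMod.val_add]
      exact_mod_cast Nat.div_add_mod _ _
    · simp only [Pi.add_apply, Sum.elim_inr, Prod.snd_add, ZMod.val_add]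
      have := Nat.div_add_mod ((i j).2.val + (k j).2.val) (p * N j)
      rw [mul_assoc, mul_left_comm] at this
      exact_mod_cast this
  · intro i k c d hc hd h
    obtain ⟨a, ha⟩ := hvc c hc
    obtain ⟨b, hb⟩ := hvc d hd
    rw [Valuation.comap_apply, Valuation.comap_apply, ha, hb, ← map_mul val, ← map_mul val,
      ← ofAdd_add,
      ← ofAdd_add] at h
    have h1 := Multiplicative.ofAdd.injective (hval h)
    funext j
    -- Values of `C` vanish modulo `N j` in the `ξ`-coordinates and modulo `p * N j` in the
    -- `η`-coordinates, leaving exactly the degrees.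
    have h2 := congrArg (Int.cast : ℤ → ZMod (N j)) (congrFun h1 (Sum.inl j))
    have h3 := congrArg (Int.cast : ℤ → ZMod (p * N j)) (congrFun h1 (Sum.inr j))
    refine Prod.ext ?_ ?_
    · simpa using h2
    · have h0 : (p : ZMod (p * N j)) * N j = 0 := by exact_mod_cast ZMod.natCast_self (p * N j)
      simpa [h0] using h3

end SymbolAlgebra

/-! ### Orders of the roots of unity, commutation of monomials, and conclusion. -/

theorem isPrimitiveRoot_of_pow_succ {K : Type*} [Field K] {p : ℕ} (hp : p.Prime) {ε : ℕ → K}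
    (h1 : ε 1 ≠ 1) (h2 : ε 1 ^ p = 1) (h3 : ∀ m, 1 ≤ m → ε (m + 1) ^ p = ε m) (m : ℕ)
    (hm : 1 ≤ m) : IsPrimitiveRoot (ε m) (p ^ m) := by
  have h4 : ∀ k, ε (k + 1) ^ p ^ k = ε 1 := fun k => by
    induction k with
    | zero => simp
    | succ k ih => rw [pow_succ', pow_mul, h3 _ (by omega), ih]
  obtain ⟨k, rfl⟩ := Nat.exists_eq_add_of_le' hm
  have := Fact.mk hp
  rw [← orderOf_eq_prime_pow (x := ε (k + 1)) (by rwa [h4]) (by rw [pow_succ, pow_mul, h4, h2])]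
  exact IsPrimitiveRoot.orderOf _

theorem IsCentralDivisionAlgebra.of_isDomain {F A : Type*} [Field F] [Ring A] [Algebra F A]
    [IsDomain A] [Module.Finite F A] (h : Subalgebra.center F A = ⊥) :
    IsCentralDivisionAlgebra F A where
  finite := inferInstance
  nontrivial := inferInstance
  isUnit_of_ne_zero a ha := by
    let := divisionRingOfFiniteDimensional F A
    exact IsUnit.mk0 a ha
  center_eq := h

theorem ZMod.dvd_val_of_pow_nsmul_eq_zero {p N k : ℕ} (hp : p ≠ 0) [NeZero (p * N)]
    {u : ZMod (p * N)} (h : p ^ (k + 1) • u = 0) : N ∣ (p ^ k • u).val ∧ N ∣ p ^ k * u.val := by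
  constructor
  · refine Nat.dvd_of_mul_dvd_mul_left (Nat.pos_of_ne_zero hp) ?_
    rw [← ZMod.natCast_eq_zero_iff, Nat.cast_mul, ZMod.natCast_zmod_val, ← nsmul_eq_mul, smul_smul,
      ← pow_succ', h]
  · refine Nat.dvd_of_mul_dvd_mul_left (Nat.pos_of_ne_zero hp) ?_
    rw [← ZMod.natCast_eq_zero_iff, ← mul_assoc, ← pow_succ', Nat.cast_mul, ZMod.natCast_zmod_val,
      ← nsmul_eq_mul, h]

/-- Both reordering factors equal `1`. Vanishing of `p ^ (k + 1)` times an `η`-degree modulo `p * N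
j` makes `p ^ k` times it divisible by `N j`, the exponent that kills `ζ j`. -/
theorem SymbolAlgebra.commute_tensorMonomial {J L S : Type*} [Fintype J] [Field L] {x t ζ : J → L}
    {N : J → ℕ} [Ring S] [Algebra L S] {p : ℕ} [NeZero p] [∀ j, NeZero (N j)]
    (e : S ≃ₐ[L] ⨂[L] j : J, SymbolAlgebra (x j) (t j) (ζ j) (N j))
    (hζ : ∀ j, ζ j ^ N j = 1) (k : ℕ) (i l : ∀ j, ZMod (N j) × ZMod (p * N j))
    (hi : p ^ (k + 1) • i = 0) (hl : p ^ (k + 1) • l = 0) :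
    Commute (tensorMonomial e fun j => (((p ^ k • i) j).1.val, ((p ^ k • i) j).2.val))
      (tensorMonomial e fun j => ((l j).1.val, (l j).2.val)) := by
  rw [commute_iff_eq, tensorMonomial_mul, tensorMonomial_mul, add_comm]
  congr 1
  have hone : ∀ j n, N j ∣ n → ζ j ^ n = 1 := fun j n ⟨c, hc⟩ => by
    rw [hc, pow_mul, hζ, one_pow]
  rw [Finset.prod_eq_one, Finset.prod_eq_one]
  · intro j _
    refine hone j _ ?_
    have h := (ZMod.dvd_val_of_pow_nsmul_eq_zero (NeZero.ne p)
      (congrArg Prod.snd (congrFun hl j))).2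
    rw [← ZMod.natCast_eq_zero_iff, Nat.cast_mul] at h ⊢
    change _ * (((p ^ k • (i j).1).val : ℕ) : ZMod (N j)) = 0
    rw [ZMod.natCast_zmod_val, nsmul_eq_mul, ← mul_assoc, mul_comm (Nat.cast _), h, zero_mul]
  · intro j _
    exact hone j _ (Dvd.dvd.mul_right (ZMod.dvd_val_of_pow_nsmul_eq_zero (NeZero.ne p)
      (congrArg Prod.snd (congrFun hi j))).1 _)

theorem proposition2p4 {K₀ C L S : Type*} [Field K₀] [IsAlgClosed K₀]
    (p : ℕ) (hp : p.Prime) (hpK : p ≠ ringChar K₀)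
    (ε : ℕ → K₀) (hε_ne : ε 1 ≠ 1) (hε_one : ε 1 ^ p = 1)
    (hε_succ : ∀ m, 1 ≤ m → ε (m + 1) ^ p = ε m)
    -- `C = K₀(x_i, y_i)` is purely transcendental with the `2n` independent generators `x_i, y_i`
    [Field C] [Algebra K₀ C] (n : ℕ) (x y : Fin n → C)
    (hxy : AlgebraicIndependent K₀ (Sum.elim x y))
    (hC : IntermediateField.adjoin K₀ (Set.range x ∪ Set.range y) = ⊤)
    -- `L` is generated over `C` by `p`-th roots `t_i` of the `y_i`
    [Field L] [Algebra C L] (t : Fin n → L)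
    (ht : ∀ i, t i ^ p = algebraMap C L (y i))
    (hL : IntermediateField.adjoin C (Set.range t) = ⊤)
    (m : Fin n → ℕ) (hm : ∀ j, 1 ≤ m j)
    -- `S` is an `L`-algebra isomorphic to the tensor product of the symbol algebras
    [Ring S] [Algebra L S] [Algebra C S] [IsScalarTower C L S]
    (e : S ≃ₐ[L] ⨂[L] j : Fin n, SymbolAlgebra (algebraMap C L (x j)) (t j)
      (algebraMap C L (algebraMap K₀ C (ε (m j)))) (p ^ m j)) :
    (∀ j, IsCentralDivisionAlgebra L (SymbolAlgebra (algebraMap C L (x j)) (t j)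
      (algebraMap C L (algebraMap K₀ C (ε (m j)))) (p ^ m j))) ∧
    IsCentralDivisionAlgebra L S ∧
    (∀ T : Subalgebra C S, Subalgebra.center C T = ⊥ ↔ T = ⊥) ∧
    (∀ j, Module.finrank L (SymbolAlgebra (algebraMap C L (x j)) (t j)
      (algebraMap C L (algebraMap K₀ C (ε (m j)))) (p ^ m j)) = p ^ (2 * m j)) := by
  have hp0 : p ≠ 0 := hp.ne_zero
  have : NeZero p := ⟨hp0⟩
  have hN0 : ∀ j, p ^ m j ≠ 0 := fun j => pow_ne_zero _ hp0
  have (j : Fin n) : NeZero (p ^ m j) := ⟨hN0 j⟩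
  have hpK0 : (p : K₀) ≠ 0 := fun h => by
    rcases (Nat.dvd_prime hp).mp (ringChar.dvd h) with h' | h'
    · exact CharP.ringChar_ne_one h'
    · exact hpK h'.symm
  have hεr := isPrimitiveRoot_of_pow_succ hp hε_ne hε_one hε_succ
  have hζ : ∀ j, IsPrimitiveRoot (algebraMap C L (algebraMap K₀ C (ε (m j)))) (p ^ m j) := fun j =>
    ((hεr _ (hm j)).map_of_injective (algebraMap K₀ C).injective).map_of_injective
      (algebraMap C L).injective
  have hx0 : ∀ j, algebraMap C L (x j) ≠ 0 := fun j => by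
    simpa using hxy.ne_zero (Sum.inl j)
  have ht0 : ∀ j, t j ≠ 0 := fun j h => by
    have := ht j
    rw [h, zero_pow hp0, eq_comm, map_eq_zero] at this
    exact hxy.ne_zero (Sum.inr j) this
  obtain ⟨Γ₀, _, v, val, hval, hvK, hvx, hvt, hvc⟩ := exists_valuation_of_adjoin_roots
    (Sum.elim x y) hxy (by rwa [Set.Sum.elim_range])
    -- These values for `x j` and `y j` give `ξ_j` and `η_j` unit vectors as values, with no
    -- denominators.
    (Sum.elim (fun j => p ^ m j) fun j => p * p ^ m j)
    (by rintro (j | j) <;> simp [hp0]) hp0 (pow_one p ▸ hεr 1 le_rfl) Sum.inr t ht hL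
    (fun j => p ^ m j) fun j => rfl
  have hε0 : ∀ j, ε (m j) ≠ 0 := fun j => (hεr _ (hm j)).ne_zero (hN0 j)
  obtain ⟨B, hB⟩ := SymbolAlgebra.exists_monomialBasis e (fun j => rfl) ht hx0 ht0 (fun j => rfl)
    hζ hL hval (fun j => hvK _ (hε0 j)) (fun j => hvx (Sum.inl j)) hvt hvc
  have := B.isDomain
  obtain ⟨BL, -⟩ := SymbolAlgebra.exists_tensorBasis e hx0 ht0 hζ
  have : Module.Finite L S := Module.Finite.of_basis BL
  refine ⟨fun j => ?_, ?_, fun T => ⟨fun hT => ?_, ?_⟩, fun j => ?_⟩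
  -- `V_j` is a domain because it embeds in `S`.
  · have := (SymbolAlgebra.single_injective e hx0 ht0 hζ j).isDomain
    obtain ⟨b, -⟩ := SymbolAlgebra.exists_basis (hx0 j) (ht0 j) (hζ j)
    have := Module.Finite.of_basis b
    exact .of_isDomain (SymbolAlgebra.center_eq_bot (hx0 j) (ht0 j) (hζ j))
  · exact .of_isDomain (SymbolAlgebra.center_tensor_eq_bot e hx0 ht0 hζ)
  -- `p ^ M` must kill every `ZMod (p * p ^ m j)`; the extra `1` in `M` accounts for the additional
  -- factor `p`.
  · refine B.eq_bot_of_center_eq_bot (p := p) (M := ∑ j, m j + 1) ?_ (fun i => ?_)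
      (fun k i l hi hl => ?_) hT
    · have h1 : (Fintype.card (∀ j, ZMod (p ^ m j) × ZMod (p * p ^ m j)) : K₀) ≠ 0 := by
        simp [Fintype.card_pi, ZMod.card, Finset.prod_ne_zero_iff, hpK0]
      simpa using hvK _ h1
    · have hdvd : ∀ j, p * p ^ m j ∣ p ^ (∑ j, m j + 1) := fun j => by
        rw [← pow_succ']
        exact pow_dvd_pow _ (Nat.succ_le_succ (Finset.single_le_sum (f := m)
          (fun _ _ => Nat.zero_le _) (Finset.mem_univ j)))
      funext j
      refine Prod.ext ?_ ?_
      · change p ^ _ • (i j).1 = 0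
        rw [nsmul_eq_mul, (ZMod.natCast_eq_zero_iff _ _).mpr ((Dvd.intro_left _ rfl).trans (hdvd j)),
          zero_mul]
      · change p ^ _ • (i j).2 = 0
        rw [nsmul_eq_mul, (ZMod.natCast_eq_zero_iff _ _).mpr (hdvd j), zero_mul]
    · rw [hB, hB]
      exact SymbolAlgebra.commute_tensorMonomial e (fun j => (hζ j).pow_eq_one) k i l hi hl
  · rintro rfl
    rw [eq_bot_iff]
    rintro ⟨z, hz⟩ -
    obtain ⟨c, rfl⟩ := Algebra.mem_bot.mp hz
    exact Algebra.mem_bot.mpr ⟨c, rfl⟩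
  · obtain ⟨b, -⟩ := SymbolAlgebra.exists_basis (hx0 j) (ht0 j) (hζ j)
    rw [Module.finrank_eq_card_basis b, Fintype.card_prod, Fintype.card_fin, two_mul, pow_add]
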